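/- **Setting.** Let $H$ be an open subset of $\mathbb C^N$ with coordinates $t^1,\dots,t^N$, carrying a holomorphic Frobenius structure for which the $t^\alpha$ are flat coordinates. This means: a constant symmetric non-degenerate matrix $g_{\alpha\beta}=(\phi_\alpha,\phi_\beta)$, $\phi_\alpha=\partial/\partial t^\alpha$, with inverse $g^{\alpha\beta}$; a holomorphic function $F$ on $H$ whose third derivatives $F_{\alpha\beta\gamma}=\partial_\alpha\partial_\beta\partial_\gamma F$ define a multiplication $\phi_\alpha\bullet\phi_\beta=F_{\alpha\beta\mu}g^{\mu\nu}\phi_\nu$ (summation convention) that makes every tangent space $T_tH$ a commutative associative algebra with $(a\bullet b,c)=(a,b\bullet c)$; and a constant vector field $\mathbf 1$ that is the unit of $\bullet$ and preserves $\bullet$. A point $p\in H$ is *semisimple* if the algebra $(T_pH,\bullet)$ is semisimple. *Canonical coordinates* on an open $V\subseteq H$ are holomorphic coordinates $u^1,\dots,u^N$ on $V$ whose coordinate fields $\partial_i=\partial/\partial u^i$ satisfy $\partial_i\bullet\partial_j=\delta_{ij}\partial_i$. Put $U=\operatorname{diag}(u^1,\dots,u^N)$, $\Delta_i=1/(\partial_i,\partial_i)$,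 and, for chosen holomorphic branches $\Delta_i^{-1/2}$ on $V$, let $\Psi=(\Psi^i_\beta)$ be given by $\Delta_i^{-1/2}du^i=\sum_\beta\Psi^i_\beta\,dt^\beta$. Consider the system $$z\,\partial_\alpha S_\beta=F_{\alpha\beta\mu}\,g^{\mu\nu}S_\nu .\qquad (*)$$ Let $R(z)=1+zR_1+z^2R_2+\cdots$ be a formal power series in $z$ whose coefficients are $N\times N$ matrices of holomorphic functions on $V$. Call $R$ a *solution on $V$* if $S=\Psi R(z)\exp(U/z)$ is a formal fundamental solution of $(*)$ on $V$, where $z\partial_\alpha\big(T(z)e^{U/z}\big)=\big(z\partial_\alpha T+T\,\partial_\alpha U\big)e^{U/z}$. Call $R$ *unitary* if $R(z)R^t(-z)=1$. The Frobenius structure is *conformal* of dimension $D\in\mathbb C$ with Euler field $E$ if $E$ is a holomorphic vector field on $H$ with $L_E(\bullet)=\bullet$, $L_E\mathbf 1=-\mathbf 1$, $L_E(\cdot,\cdot)=(2-D)(\cdot,\cdot)$. Then $R$ is called *homogeneous* if $E R_k=-kR_k$ (entrywise derivative along $E$) for all $k\ge 0$. **Proposition.** Let $p\in H$ be a semisimple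 point. Then $p$ has a convex open neighbourhood on which canonical coordinates and holomorphic branches of all $\Delta_i^{-1/2}$ exist. Moreover, for every convex (in the coordinates $t^\alpha$) open neighbourhood $V\subseteq H$ of $p$ and every choice of canonical coordinates $u^i$ and holomorphic branches of $\Delta_i^{-1/2}$ on $V$: 1. There is a solution $R$ on $V$ that is unitary. (In particular $(*)$ has a formal fundamental solution $\Psi R(z)\exp(U/z)$ with $R=1+zR_1+\cdots$.) 2. The unitary solution is unique exactly up to right multiplication by constant diagonal matrices $\exp(a_1z+a_2z^3+a_3z^5+\cdots)$: if $R$ is a unitary solution on $V$, then $R'$ is a unitary solution on $V$ if and only if $R'=R\,\exp(a_1z+a_2z^3+a_3z^5+\cdots)$ on $V$ for some constant complex diagonal matrices $a_k=\operatorname{diag}(a_k^1,\dots,a_k^N)$. 3. If the Frobenius structure is conformal with Euler field $E$, there is exactly one homogeneous solution $R$ on $V$, and it is unitary. -/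

import Mathlib

open scoped Matrix PowerSeries

noncomputable section

/-- Points, and tangent vectors in the flat frame `φ_α = ∂/∂t^α`, of an open piece of `ℂ^N`. -/
abbrev Pt (N : ℕ) : Type := Fin N → ℂ

/-- The partial derivative `∂_α f = ∂f/∂t^α`. -/
def pd {N : ℕ} (α : Fin N) (f : Pt N → ℂ) (t : Pt N) : ℂ :=
  fderiv ℂ f t (Pi.single α 1)

/-- The third derivatives `F_{αβγ} = ∂_α ∂_β ∂_γ F`. -/
def third {N : ℕ} (F : Pt N → ℂ) (α β γ : Fin N) (t : Pt N) : ℂ :=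
  pd α (pd β (pd γ F)) t

/-- The pairing `(a, b) = g_{αβ} a^α b^β`. -/
def pairing {N : ℕ} (g : Matrix (Fin N) (Fin N) ℂ) (a b : Pt N) : ℂ :=
  ∑ α, ∑ β, g α β * a α * b β

/-- The product at `t` with `(φ_α • φ_β, φ_μ) = F_{αβμ}(t)`, that is
`φ_α • φ_β = F_{αβμ} g^{μν} φ_ν`. -/
def frobMul {N : ℕ} (g : Matrix (Fin N) (Fin N) ℂ) (F : Pt N → ℂ) (t a b : Pt N) : Pt N :=
  fun ν => ∑ α, ∑ β, ∑ μ, a α * b β * third F α β μ t * g⁻¹ μ ν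

/-- A (holomorphic) Frobenius structure in flat coordinates `t^1, …, t^N` with domain `dom`.
The flat metric has constant coefficients `g`, and covariantly constant vector fields are
those with constant components; such a field preserves the metric. -/
structure FrobeniusStructure (N : ℕ) where
  /-- the domain of the flat coordinates -/
  dom : Set (Pt N)
  isOpen_dom : IsOpen dom
  /-- the flat metric `g_{αβ} = (φ_α, φ_β)` -/
  g : Matrix (Fin N) (Fin N) ℂ
  g_symm : g.IsSymm
  g_nondeg : IsUnit g.det
  /-- the potential -/
  F : Pt N → ℂ
  analytic_F : AnalyticOnNhd ℂ F dom
  mul_comm' : ∀ t ∈ dom, ∀ a b, frobMul g F t a b = frobMul g F t b a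
  mul_assoc' : ∀ t ∈ dom, ∀ a b c,
    frobMul g F t (frobMul g F t a b) c = frobMul g F t a (frobMul g F t b c)
  mul_invariant : ∀ t ∈ dom, ∀ a b c,
    pairing g (frobMul g F t a b) c = pairing g a (frobMul g F t b c)
  /-- the (constant) components of the unit vector field -/
  unit : Pt N
  unit_mul : ∀ t ∈ dom, ∀ a, frobMul g F t unit a = a
  /-- the unit field preserves the multiplication -/
  unit_preserves_mul : ∀ t ∈ dom, ∀ α β γ, fderiv ℂ (third F α β γ) t unit = 0

namespace FrobeniusStructure

variable {N : ℕ}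

/-- The multiplication `a • b` on the tangent space at `t`. -/
def mul (Fr : FrobeniusStructure N) (t a b : Pt N) : Pt N := frobMul Fr.g Fr.F t a b

/-- The algebra `(T_t H, •)`. -/
def TangentAlgebra (Fr : FrobeniusStructure N) (_t : Fr.dom) : Type := Pt N

instance (Fr : FrobeniusStructure N) (t : Fr.dom) : AddCommGroup (Fr.TangentAlgebra t) :=
  inferInstanceAs (AddCommGroup (Pt N))

theorem mul_add' (Fr : FrobeniusStructure N) (t a b c : Pt N) :
    Fr.mul t a (b + c) = Fr.mul t a b + Fr.mul t a c := by
  funext ν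
  simp [mul, frobMul, mul_add, add_mul, Finset.sum_add_distrib]

theorem add_mul' (Fr : FrobeniusStructure N) (t a b c : Pt N) :
    Fr.mul t (a + b) c = Fr.mul t a c + Fr.mul t b c := by
  funext ν
  simp [mul, frobMul, add_mul, Finset.sum_add_distrib]

instance (Fr : FrobeniusStructure N) (t : Fr.dom) : CommRing (Fr.TangentAlgebra t) where
  __ := (inferInstance : AddCommGroup (Fr.TangentAlgebra t))
  mul a b := Fr.mul t a b
  one := Fr.unit
  left_distrib a b c := Fr.mul_add' t a b c
  right_distrib a b c := Fr.add_mul' t a b c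
  zero_mul a := by
    have h := Fr.add_mul' t 0 0 a
    rw [add_zero] at h
    exact left_eq_add.mp h
  mul_zero a := by
    have h := Fr.mul_add' t a 0 0
    rw [add_zero] at h
    exact left_eq_add.mp h
  mul_assoc a b c := Fr.mul_assoc' t t.2 a b c
  mul_comm a b := Fr.mul_comm' t t.2 a b
  one_mul a := Fr.unit_mul t t.2 a
  mul_one a := (Fr.mul_comm' t t.2 a Fr.unit).trans (Fr.unit_mul t t.2 a)

/-- `t` is a semisimple point: the algebra `(T_t H, •)` is semisimple. -/
def IsSemisimpleAt (Fr : FrobeniusStructure N) (t : Fr.dom) : Prop :=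
  IsSemisimpleRing (Fr.TangentAlgebra t)

end FrobeniusStructure

/-! ### Canonical coordinates -/

/-- The Jacobian matrix `∂u^i/∂t^β` (row `i`, column `β`). -/
def jacobian {N : ℕ} (u : Fin N → Pt N → ℂ) (t : Pt N) : Matrix (Fin N) (Fin N) ℂ :=
  Matrix.of fun i β => pd β (u i) t

/-- The coordinate vector field `∂_i = ∂/∂u^i`, with components `∂t^β/∂u^i`. -/
def coordVec {N : ℕ} (u : Fin N → Pt N → ℂ) (i : Fin N) (t : Pt N) : Pt N :=
  fun β => (jacobian u t)⁻¹ β i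

/-- `u^1, …, u^N` are canonical coordinates on `V`: a holomorphic coordinate system on `V` whose
coordinate vector fields `∂_i` satisfy `∂_i • ∂_j = δ_{ij} ∂_i`. -/
structure IsCanonicalCoordinates {N : ℕ} (Fr : FrobeniusStructure N) (V : Set (Pt N))
    (u : Fin N → Pt N → ℂ) : Prop where
  subset_dom : V ⊆ Fr.dom
  analytic : ∀ i, AnalyticOnNhd ℂ (u i) V
  injOn : Set.InjOn (fun t i => u i t) V
  jacobian_unit : ∀ t ∈ V, IsUnit (jacobian u t).det
  idempotent : ∀ t ∈ V, ∀ i j,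
    Fr.mul t (coordVec u i t) (coordVec u j t) = if i = j then coordVec u i t else 0

/-- `Δ_i = 1 / (∂_i, ∂_i)`. -/
def hessian {N : ℕ} (Fr : FrobeniusStructure N) (u : Fin N → Pt N → ℂ) (i : Fin N)
    (t : Pt N) : ℂ :=
  1 / pairing Fr.g (coordVec u i t) (coordVec u i t)

/-- `s_i` is a holomorphic branch of `Δ_i^{-1/2}` on `V`. -/
def IsInvSqrtHessian {N : ℕ} (Fr : FrobeniusStructure N) (V : Set (Pt N))
    (u s : Fin N → Pt N → ℂ) : Prop :=
  ∀ i, AnalyticOnNhd ℂ (s i) V ∧ ∀ t ∈ V, s i t ^ 2 = (hessian Fr u i t)⁻¹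

/-- The transition matrix `Ψ` (row `β`, column `i`): `Δ_i^{-1/2} du^i = ∑_β Ψ_β^i dt^β`. -/
def transition {N : ℕ} (u s : Fin N → Pt N → ℂ) (t : Pt N) : Matrix (Fin N) (Fin N) ℂ :=
  Matrix.of fun β i => s i t * pd β (u i) t

/-! ### Formal series in `z` (the variable `X` of `ℂ⟦X⟧`) with exponential factor `exp (U/z)` -/

/-- Matrix power series in `z` depending on a point. -/
abbrev MatrixSeries (N : ℕ) : Type := Pt N → Matrix (Fin N) (Fin N) ℂ⟦X⟧

/-- A formal expression `T(z) exp (U/z)`, with `T` a matrix power series in `z` and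
`U = diag (u^1, …, u^N)`. -/
structure FormalOscillation (N : ℕ) where
  /-- the factor `T(z) = T_0 + z T_1 + …` -/
  amp : MatrixSeries N
  /-- the diagonal entries of `U` -/
  phase : Fin N → Pt N → ℂ

/-- The coefficientwise partial derivative `∂_α T` of a matrix power series. -/
def MatrixSeries.pd {N : ℕ} (α : Fin N) (T : MatrixSeries N) : MatrixSeries N :=
  fun t => Matrix.of fun i j =>
    PowerSeries.mk fun k => _root_.pd α (fun x => PowerSeries.coeff k (T x i j)) t

/-- A matrix of numbers as a constant power series. -/
def constSeries {N : ℕ} (A : Matrix (Fin N) (Fin N) ℂ) : Matrix (Fin N) (Fin N) ℂ⟦X⟧ :=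
  A.map PowerSeries.C

namespace FormalOscillation

variable {N : ℕ}

/-- `z ∂_α (T exp (U/z)) = (z ∂_α T + T ∂_α U) exp (U/z)`. -/
def zderiv (α : Fin N) (S : FormalOscillation N) : FormalOscillation N where
  amp t := (PowerSeries.X : ℂ⟦X⟧) • MatrixSeries.pd α S.amp t
    + S.amp t * constSeries (Matrix.diagonal fun i => pd α (S.phase i) t)
  phase := S.phase

/-- `A · (T exp (U/z)) = (A T) exp (U/z)` for a matrix function `A`. -/
def lmul (A : Pt N → Matrix (Fin N) (Fin N) ℂ) (S : FormalOscillation N) :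
    FormalOscillation N where
  amp t := constSeries (A t) * S.amp t
  phase := S.phase

/-- Equality of two expressions over `V`, with one and the same factor `exp (U/z)`. -/
def EqOn (V : Set (Pt N)) (S S' : FormalOscillation N) : Prop :=
  S.phase = S'.phase ∧ Set.EqOn S.amp S'.amp V

end FormalOscillation

/-- The matrix `(F_{αβμ} g^{μν})_{β,ν}`. -/
def FrobeniusStructure.connMatrix {N : ℕ} (Fr : FrobeniusStructure N) (α : Fin N) (t : Pt N) :
    Matrix (Fin N) (Fin N) ℂ :=
  Matrix.of fun β ν => ∑ μ, third Fr.F α β μ t * Fr.g⁻¹ μ ν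

/-- `S` (row `β`, one solution in each column) is a fundamental solution over `V` of
`z ∂_α S_β = F_{αβμ} g^{μν} S_ν`. -/
def IsFundamentalSolution {N : ℕ} (Fr : FrobeniusStructure N) (V : Set (Pt N))
    (S : FormalOscillation N) : Prop :=
  (∀ α, (S.zderiv α).EqOn V (S.lmul (Fr.connMatrix α))) ∧ ∀ t ∈ V, IsUnit (S.amp t).det

/-- The expression `Ψ R(z) exp (U/z)`. -/
def asymptoticS {N : ℕ} (u s : Fin N → Pt N → ℂ) (R : MatrixSeries N) : FormalOscillation N where
  amp t := constSeries (transition u s t) * R t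
  phase := u

/-- `R = 1 + z R_1 + z² R_2 + …`, with coefficients holomorphic on `V`, is such that
`Ψ R(z) exp (U/z)` is a fundamental solution over `V`. -/
structure IsAsymptoticSolution {N : ℕ} (Fr : FrobeniusStructure N) (V : Set (Pt N))
    (u s : Fin N → Pt N → ℂ) (R : MatrixSeries N) : Prop where
  analytic : ∀ k i j, AnalyticOnNhd ℂ (fun t => PowerSeries.coeff k (R t i j)) V
  zeroth : ∀ t ∈ V, (R t).map PowerSeries.constantCoeff = 1
  solution : IsFundamentalSolution Fr V (asymptoticS u s R)

/-- The unitary condition `R(z) Rᵗ(-z) = 1` over `V`. -/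
def IsUnitary {N : ℕ} (V : Set (Pt N)) (R : MatrixSeries N) : Prop :=
  ∀ t ∈ V, R t * ((R t).map PowerSeries.evalNegHom)ᵀ = 1

/-- The constant diagonal matrix series `exp (a_1 z + a_2 z³ + a_3 z⁵ + …)`, where
`a_{k+1} = diag (a k 1, …, a k N)`. -/
def diagExp {N : ℕ} (a : ℕ → Fin N → ℂ) : Matrix (Fin N) (Fin N) ℂ⟦X⟧ :=
  Matrix.diagonal fun i => (PowerSeries.exp ℂ).subst
    (PowerSeries.mk fun m => if Odd m then a (m / 2) i else 0 : ℂ⟦X⟧)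

/-! ### The conformal case -/

/-- `E` is an Euler vector field, of dimension `D`: `L_E • = •`, `L_E 1 = -1` and
`L_E (·,·) = (2 - D) (·,·)`. Lie derivatives of tensor fields are evaluated on vector fields
`a`, `b` with constant components, on which `(a, b)` is constant. -/
structure IsEulerField {N : ℕ} (Fr : FrobeniusStructure N) (E : Pt N → Pt N) (D : ℂ) : Prop where
  analytic : AnalyticOnNhd ℂ E Fr.dom
  lie_mul : ∀ t ∈ Fr.dom, ∀ a b : Pt N,
    VectorField.lieBracket ℂ E (fun x => Fr.mul x a b) t
      - Fr.mul t (VectorField.lieBracket ℂ E (fun _ => a) t) b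
      - Fr.mul t a (VectorField.lieBracket ℂ E (fun _ => b) t) = Fr.mul t a b
  lie_unit : ∀ t ∈ Fr.dom, VectorField.lieBracket ℂ E (fun _ => Fr.unit) t = -Fr.unit
  lie_metric : ∀ t ∈ Fr.dom, ∀ a b : Pt N,
    fderiv ℂ (fun _ => pairing Fr.g a b) t (E t)
      - pairing Fr.g (VectorField.lieBracket ℂ E (fun _ => a) t) b
      - pairing Fr.g a (VectorField.lieBracket ℂ E (fun _ => b) t)
      = (2 - D) * pairing Fr.g a b

/-- `R` is homogeneous over `V` (with `z` of degree one): `E R_k = -k R_k` for all `k`. -/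
def IsHomogeneous {N : ℕ} (V : Set (Pt N)) (E : Pt N → Pt N) (R : MatrixSeries N) : Prop :=
  ∀ t ∈ V, ∀ (k : ℕ) (i j : Fin N),
    fderiv ℂ (fun x => PowerSeries.coeff k (R x i j)) t (E t)
      = -(k : ℂ) * PowerSeries.coeff k (R t i j)

end

/-! ### The exponential of a formal power series -/

namespace PowerSeries

/-! Over the ring of holomorphic functions on V, Ψ diagonalizes the matrices C_α of (*), with
eigenvalues ∂_α u^i, and ΨΨᵗ = g. For ω = Ψ⁻¹dΨ and ∇ = d + ω, the system (*) becomes ∇_α R_k = [∂_α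
U, R_{k+1}] for all k, with R_{-1} = 0 (`CanonicalFrame.isSolution_iff`). Constancy of g makes ω
skew, equality of mixed derivatives of Ψ makes ∇ flat, and the symmetry of ∂_β C_α in α, β makes
[ω_α, ∂_β U] symmetric.

Existence (`exists_next`): flatness gives the compatibility needed to solve for the off-diagonal
entries of R_{k+1} algebraically, because the du^i are independent. The diagonal entries are
primitives of forms that are closed by the same compatibility one step further; the Poincaré lemma
on the convex set V applies.

Unitarity and uniqueness rest on `IsSolution.exists_reflect_mul_eq`: for two solutions, Q =
Rᵗ(-z)R'(z) satisfies z ∂_α Q = [∂_α U, Q], so Q is diagonal and constant. If R' = R, then Q is even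
with constant term 1, and its inverse square root corrects R to a unitary solution. If R is unitary,
then R' = RQ with Q = exp b, and R' is unitary exactly when b is odd.

In the conformal case L = z d/dz + E preserves the equation, so LR = Rq with q constant diagonal and
q(0) = 0; right multiplication by a solution T of zT' = -qT achieves LR = 0. For homogeneous R and
R', Q is annihilated by z d/dz and hence is 1, which yields both unitarity and uniqueness.

Canonical coordinates come from the splitting of T_pH into copies of ℂ. Its idempotents extend by
the implicit function theorem, stay orthogonal, and have a dual coframe that is closed by the
symmetry of ∂_β C_α. -/

theorem hasSubst_of_constantCoeff {b : ℂ⟦X⟧} (hb : constantCoeff b = 0) : HasSubst b :=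
  HasSubst.of_constantCoeff_zero' hb

theorem derivative_exp_subst {b : ℂ⟦X⟧} (hb : constantCoeff b = 0) :
    d⁄dX ℂ ((exp ℂ).subst b) = (exp ℂ).subst b * d⁄dX ℂ b := by
  rw [derivative_subst (hasSubst_of_constantCoeff hb), derivative_exp]

theorem constantCoeff_exp_subst {b : ℂ⟦X⟧} (hb : constantCoeff b = 0) :
    constantCoeff ((exp ℂ).subst b : ℂ⟦X⟧) = 1 := by
  have h : (exp ℂ : ℂ⟦X⟧) = (exp ℂ - 1) + 1 := by ring
  have hs := hasSubst_of_constantCoeff hb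
  have h1 : (subst b (1 : ℂ⟦X⟧) : ℂ⟦X⟧) = 1 := by
    rw [← coe_substAlgHom hs, map_one]
  rw [h, subst_add hs, h1, map_add]
  have h0 : constantCoeff ((exp ℂ - 1 : ℂ⟦X⟧).subst b : ℂ⟦X⟧) = 0 :=
    constantCoeff_subst_eq_zero hb _ (by simp [constantCoeff_exp])
  rw [h0]
  simp

/-- The quotient g f⁻¹ has derivative zero and constant term 1. This uniqueness principle for y' =
yh replaces manipulation of the exponential series. -/
theorem eq_of_derivative_eq_mul {f g h : ℂ⟦X⟧} (hf : d⁄dX ℂ f = f * h) (hg : d⁄dX ℂ g = g * h)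
    (hf1 : constantCoeff f = 1) (hg1 : constantCoeff g = 1) : f = g := by
  have hu : f * f⁻¹ = 1 := PowerSeries.mul_inv_cancel _ (by rw [hf1]; exact one_ne_zero)
  have key : g * f⁻¹ = 1 := by
    apply derivative.ext (R := ℂ)
    · rw [Derivation.leibniz, derivative_inv', hf, hg]
      simp only [smul_eq_mul, derivative_one]
      linear_combination (-(g * f⁻¹ * h)) * hu
    · simp [hf1, hg1]
  calc f = (g * f⁻¹) * f := by rw [key, one_mul]
    _ = g * (f * f⁻¹) := by ring
    _ = g := by rw [hu, mul_one]

theorem exp_subst_add {b c : ℂ⟦X⟧} (hb : constantCoeff b = 0) (hc : constantCoeff c = 0) :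
    (exp ℂ).subst (b + c) = ((exp ℂ).subst b * (exp ℂ).subst c : ℂ⟦X⟧) := by
  have hbc : constantCoeff (b + c) = 0 := by rw [map_add, hb, hc, add_zero]
  refine eq_of_derivative_eq_mul (derivative_exp_subst hbc) ?_ (constantCoeff_exp_subst hbc) ?_
  · rw [Derivation.leibniz, derivative_exp_subst hb, derivative_exp_subst hc, map_add]
    simp only [smul_eq_mul]
    ring
  · rw [map_mul, constantCoeff_exp_subst hb, constantCoeff_exp_subst hc, one_mul]

theorem exp_subst_zero : ((exp ℂ).subst (0 : ℂ⟦X⟧) : ℂ⟦X⟧) = 1 :=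
  eq_of_derivative_eq_mul (h := 0)
    (by rw [derivative_exp_subst (map_zero _), map_zero]) (by simp)
    (constantCoeff_exp_subst (map_zero _)) (map_one _)

theorem exists_derivative_eq (f : ℂ⟦X⟧) : ∃ b : ℂ⟦X⟧, constantCoeff b = 0 ∧ d⁄dX ℂ b = f := by
  refine ⟨mk fun n => if n = 0 then 0 else coeff (n - 1) f / n, by simp, ?_⟩
  ext n
  rw [coeff_derivative, coeff_mk, if_neg n.succ_ne_zero]
  have : ((n : ℂ) + 1) ≠ 0 := by exact_mod_cast n.succ_ne_zero
  push_cast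
  exact div_mul_cancel₀ _ this

/-- The logarithm is the formal primitive of f'/f with zero constant term. -/
theorem exists_exp_subst_eq {f : ℂ⟦X⟧} (hf : constantCoeff f = 1) :
    ∃ b : ℂ⟦X⟧, constantCoeff b = 0 ∧ (exp ℂ).subst b = f := by
  obtain ⟨b, hb, hb'⟩ := exists_derivative_eq (d⁄dX ℂ f * f⁻¹)
  have hu : f * f⁻¹ = 1 := PowerSeries.mul_inv_cancel _ (by rw [hf]; exact one_ne_zero)
  refine ⟨b, hb, eq_of_derivative_eq_mul (derivative_exp_subst hb) ?_
    (constantCoeff_exp_subst hb) hf⟩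
  rw [hb']
  linear_combination (-d⁄dX ℂ f) * hu

theorem exp_subst_injective {b c : ℂ⟦X⟧} (hb : constantCoeff b = 0) (hc : constantCoeff c = 0)
    (h : ((exp ℂ).subst b : ℂ⟦X⟧) = (exp ℂ).subst c) : b = c := by
  apply derivative.ext (R := ℂ) _ (by rw [hb, hc])
  have h1 := derivative_exp_subst hb
  rw [h, derivative_exp_subst hc] at h1
  refine (mul_left_cancel₀ ?_ h1).symm
  intro h0
  have := constantCoeff_exp_subst hc
  rw [h0, map_zero] at this
  exact zero_ne_one this

theorem coeff_evalNegHom {A : Type*} [CommRing A] (n : ℕ) (f : A⟦X⟧) :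
    coeff n (evalNegHom f) = (-1) ^ n * coeff n f := by
  simp [evalNegHom, coeff_rescale]

theorem constantCoeff_evalNegHom {A : Type*} [CommRing A] (f : A⟦X⟧) :
    constantCoeff (evalNegHom f) = constantCoeff f := by
  rw [← coeff_zero_eq_constantCoeff_apply, coeff_evalNegHom]
  simp

theorem derivative_evalNegHom {A : Type*} [CommRing A] (f : A⟦X⟧) :
    d⁄dX A (evalNegHom f) = -evalNegHom (d⁄dX A f) := by
  ext n
  simp only [coeff_derivative, coeff_evalNegHom, map_neg]
  ring

theorem evalNegHom_evalNegHom {A : Type*} [CommRing A] (f : A⟦X⟧) :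
    evalNegHom (evalNegHom f) = f := by
  ext n
  rw [coeff_evalNegHom, coeff_evalNegHom, ← mul_assoc, ← mul_pow]
  simp

theorem evalNegHom_exp_subst {b : ℂ⟦X⟧} (hb : constantCoeff b = 0) :
    evalNegHom ((exp ℂ).subst b : ℂ⟦X⟧) = (exp ℂ).subst (evalNegHom b) := by
  have hb' : constantCoeff (evalNegHom b) = 0 := by rw [constantCoeff_evalNegHom, hb]
  refine eq_of_derivative_eq_mul (h := -evalNegHom (d⁄dX ℂ b)) ?_ ?_ ?_ ?_
  · rw [derivative_evalNegHom, derivative_exp_subst hb, map_mul, mul_neg]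
  · rw [derivative_exp_subst hb', derivative_evalNegHom]
  · rw [constantCoeff_evalNegHom, constantCoeff_exp_subst hb]
  · exact constantCoeff_exp_subst hb'

theorem evalNegHom_map {A B : Type*} [CommRing A] [CommRing B] (φ : A →+* B) (f : A⟦X⟧) :
    evalNegHom (map φ f) = map φ (evalNegHom f) := by
  ext n
  simp [coeff_evalNegHom]

/-- The odd series are those of the form `a₁ z + a₂ z³ + a₃ z⁵ + ⋯`. -/
theorem evalNegHom_eq_neg_iff {b : ℂ⟦X⟧} :
    evalNegHom b = -b ↔ ∃ a : ℕ → ℂ, b = mk fun m => if Odd m then a (m / 2) else 0 := by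
  constructor
  · intro h
    refine ⟨fun k => coeff (2 * k + 1) b, ?_⟩
    ext m
    rw [coeff_mk]
    split_ifs with hm
    · obtain ⟨k, rfl⟩ := hm
      congr 2
      omega
    · have := congrArg (coeff m) h
      rw [coeff_evalNegHom, (Nat.not_odd_iff_even.mp hm).neg_one_pow, one_mul, map_neg] at this
      exact self_eq_neg.mp this
  · rintro ⟨a, rfl⟩
    ext m
    rw [coeff_evalNegHom, map_neg, coeff_mk]
    split_ifs with hm
    · rw [hm.neg_one_pow, neg_one_mul]
    · simp

/-- The product is exp(b(z) + b(-z)), and exp is injective on series without constant term. -/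
theorem exp_subst_mul_evalNegHom_eq_one_iff {b : ℂ⟦X⟧} (hb : constantCoeff b = 0) :
    ((exp ℂ).subst b * evalNegHom ((exp ℂ).subst b) : ℂ⟦X⟧) = 1 ↔ evalNegHom b = -b := by
  have hb' : constantCoeff (evalNegHom b) = 0 := by rw [constantCoeff_evalNegHom, hb]
  rw [evalNegHom_exp_subst hb, ← exp_subst_add hb hb', ← exp_subst_zero]
  constructor
  · intro h
    have := exp_subst_injective (by rw [map_add, hb, hb', add_zero]) (map_zero _) h
    linear_combination this
  · intro h
    rw [h, add_neg_cancel]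

/-- An even series with constant term `1` has an even inverse square root. -/
theorem exists_mul_evalNegHom_mul_eq_one {q : ℂ⟦X⟧} (hq : constantCoeff q = 1)
    (hqe : evalNegHom q = q) :
    ∃ T : ℂ⟦X⟧, constantCoeff T = 1 ∧ evalNegHom T * q * T = 1 := by
  obtain ⟨b, hb, rfl⟩ := exists_exp_subst_eq hq
  have hb' : constantCoeff (evalNegHom b) = 0 := by rw [constantCoeff_evalNegHom, hb]
  rw [evalNegHom_exp_subst hb] at hqe
  have hbe := exp_subst_injective hb' hb hqe
  -- Here q = exp b with b even. The series T = exp(-b/2) is then even too, and the three exponents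
  -- -b/2, b, -b/2 add up to zero.
  set c : ℂ⟦X⟧ := C (-1 / 2 : ℂ) * b with hc
  have hc0 : constantCoeff c = 0 := by rw [hc, map_mul, hb, mul_zero]
  have hce : evalNegHom c = c := by
    ext n
    have := congrArg (coeff n) hbe
    rw [coeff_evalNegHom] at this ⊢
    rw [hc, coeff_C_mul, mul_left_comm, this]
  refine ⟨(exp ℂ).subst c, constantCoeff_exp_subst hc0, ?_⟩
  rw [evalNegHom_exp_subst hc0, hce, ← exp_subst_add hc0 hb,
    ← exp_subst_add (by rw [map_add, hc0, hb, add_zero]) hc0, ← exp_subst_zero]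
  congr 1
  have h1 : (C (-1 / 2 : ℂ) + 1 + C (-1 / 2 : ℂ) : ℂ⟦X⟧) = 0 := by
    rw [← map_one C, ← map_add, ← map_add]
    norm_num
  rw [hc]
  linear_combination b * h1

/-- Series with constant term `1` and a prescribed logarithmic derivative. -/
theorem exists_X_mul_derivative_eq {c : ℂ⟦X⟧} (hc : constantCoeff c = 0) :
    ∃ T : ℂ⟦X⟧, constantCoeff T = 1 ∧ X * d⁄dX ℂ T = -(c * T) := by
  -- Writing c = z d turns the equation into T' = -dT, which the exponential of a primitive of -d
  -- solves.
  obtain ⟨d, hd⟩ := X_dvd_iff.mpr hc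
  obtain ⟨b, hb, hb'⟩ := exists_derivative_eq (-d)
  refine ⟨(exp ℂ).subst b, constantCoeff_exp_subst hb, ?_⟩
  rw [derivative_exp_subst hb, hb', hd]
  ring

end PowerSeries

/-! ### Derivations on matrices and on power series -/

namespace Derivation

variable {B n : Type*} [CommRing B] [Algebra ℂ B]

theorem matrix_mul [Fintype n] (δ : Derivation ℂ B B) (X Y : Matrix n n B) :
    (X * Y).map δ = X.map δ * Y + X * Y.map δ := by
  ext i j
  simp only [Matrix.map_apply, Matrix.mul_apply, Matrix.add_apply, map_sum, leibniz, smul_eq_mul,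
    ← Finset.sum_add_distrib]
  refine Finset.sum_congr rfl fun k _ => ?_
  ring

theorem matrix_add (δ : Derivation ℂ B B) (X Y : Matrix n n B) :
    (X + Y).map δ = X.map δ + Y.map δ := by
  ext i j
  simp

theorem matrix_sub (δ : Derivation ℂ B B) (X Y : Matrix n n B) :
    (X - Y).map δ = X.map δ - Y.map δ := by
  ext i j
  simp

theorem matrix_diagonal [DecidableEq n] (δ : Derivation ℂ B B) (d : n → B) :
    (Matrix.diagonal d).map δ = Matrix.diagonal fun i => δ (d i) :=
  Matrix.diagonal_map (map_zero δ)

theorem matrix_one [DecidableEq n] (δ : Derivation ℂ B B) : (1 : Matrix n n B).map δ = 0 := by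
  rw [← Matrix.diagonal_one, matrix_diagonal]
  simp

end Derivation

namespace PowerSeries

variable {A : Type*} [CommRing A] [Algebra ℂ A]

/-- The extension of a derivation to power series, acting on the coefficients. -/
noncomputable def coeffDerivation (δ : Derivation ℂ A A) : Derivation ℂ A⟦X⟧ A⟦X⟧ :=
  Derivation.mk'
    { toFun := fun f => mk fun k => δ (coeff k f)
      map_add' := fun f g => by ext k; simp
      map_smul' := fun c f => by ext k; simp }
    (fun f g => by
      ext k
      simp only [LinearMap.coe_mk, AddHom.coe_mk, coeff_mk, coeff_mul, map_sum, smul_eq_mul,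
        map_add, Derivation.leibniz, Finset.sum_add_distrib]
      congr 1
      rw [← Finset.Nat.sum_antidiagonal_swap]
      rfl)

@[simp]
theorem coeff_coeffDerivation (δ : Derivation ℂ A A) (f : A⟦X⟧) (k : ℕ) :
    coeff k (coeffDerivation δ f) = δ (coeff k f) := by
  simp [coeffDerivation]

@[simp]
theorem coeffDerivation_C (δ : Derivation ℂ A A) (a : A) :
    coeffDerivation δ (C a) = C (δ a) := by
  ext k
  rw [coeff_coeffDerivation, coeff_C, coeff_C]
  split_ifs <;> simp

theorem coeffDerivation_X (δ : Derivation ℂ A A) : coeffDerivation δ (X : A⟦X⟧) = 0 := by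
  ext k
  rw [coeff_coeffDerivation, coeff_X]
  split_ifs <;> simp

theorem evalNegHom_coeffDerivation (δ : Derivation ℂ A A) (f : A⟦X⟧) :
    evalNegHom (coeffDerivation δ f) = coeffDerivation δ (evalNegHom f) := by
  ext k
  rw [coeff_evalNegHom, coeff_coeffDerivation, coeff_coeffDerivation, coeff_evalNegHom]
  rcases neg_one_pow_eq_or A k with h | h <;> simp [h]

/-- The derivation `z d/dz + δ`. -/
noncomputable def eulerDerivation (δ : Derivation ℂ A A) : Derivation ℂ A⟦X⟧ A⟦X⟧ :=
  (X : A⟦X⟧) • (d⁄dX A).restrictScalars ℂ + coeffDerivation δ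

theorem eulerDerivation_apply (δ : Derivation ℂ A A) (f : A⟦X⟧) :
    eulerDerivation δ f = X * d⁄dX A f + coeffDerivation δ f := rfl

theorem coeff_eulerDerivation (δ : Derivation ℂ A A) (f : A⟦X⟧) (k : ℕ) :
    coeff k (eulerDerivation δ f) = k * coeff k f + δ (coeff k f) := by
  rw [eulerDerivation_apply, map_add, coeff_coeffDerivation]
  cases k with
  | zero => simp
  | succ k =>
    rw [coeff_succ_X_mul, coeff_derivative]
    push_cast
    ring

theorem eulerDerivation_C (δ : Derivation ℂ A A) (a : A) :
    eulerDerivation δ (C a) = C (δ a) := by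
  rw [eulerDerivation_apply, derivative_C, coeffDerivation_C, mul_zero, zero_add]

theorem eulerDerivation_X (δ : Derivation ℂ A A) : eulerDerivation δ (X : A⟦X⟧) = X := by
  rw [eulerDerivation_apply, derivative_X, coeffDerivation_X, mul_one, add_zero]

/-- The operator z d/dz + δ acts on each power of z separately, so unlike d/dz it commutes with z ↦
-z without a sign. -/
theorem evalNegHom_eulerDerivation (δ : Derivation ℂ A A) (f : A⟦X⟧) :
    evalNegHom (eulerDerivation δ f) = eulerDerivation δ (evalNegHom f) := by
  ext k
  rw [coeff_evalNegHom, coeff_eulerDerivation, coeff_eulerDerivation, coeff_evalNegHom]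
  rcases neg_one_pow_eq_or A k with h | h
  · simp [h]
  · simp only [h, neg_mul, one_mul, map_neg]
    ring

end PowerSeries

/-! ### Coefficient matrices of matrix power series -/

namespace PowerSeries

variable {A : Type*} [CommRing A] {N : ℕ}

/-- The matrix of coefficients of `z^k`. -/
noncomputable def coeffMat (k : ℕ) (R : Matrix (Fin N) (Fin N) A⟦X⟧) : Matrix (Fin N) (Fin N) A :=
  R.map (coeff k)

theorem coeffMat_C_mul (k : ℕ) (Y : Matrix (Fin N) (Fin N) A)
    (R : Matrix (Fin N) (Fin N) A⟦X⟧) :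
    coeffMat k (Y.map C * R) = Y * coeffMat k R := by
  ext i j
  simp [coeffMat, Matrix.mul_apply]

theorem coeffMat_mul_C (k : ℕ) (Y : Matrix (Fin N) (Fin N) A)
    (R : Matrix (Fin N) (Fin N) A⟦X⟧) :
    coeffMat k (R * Y.map C) = coeffMat k R * Y := by
  ext i j
  simp [coeffMat, Matrix.mul_apply]

theorem coeffMat_ext {R R' : Matrix (Fin N) (Fin N) A⟦X⟧}
    (h : ∀ k, coeffMat k R = coeffMat k R') : R = R' := by
  ext i j k
  exact congrFun (congrFun (h k) i) j

theorem coeffMat_sub (k : ℕ) (R R' : Matrix (Fin N) (Fin N) A⟦X⟧) :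
    coeffMat k (R - R') = coeffMat k R - coeffMat k R' := by
  ext i j
  simp [coeffMat]

theorem coeffMat_zero_X_smul (R : Matrix (Fin N) (Fin N) A⟦X⟧) :
    coeffMat 0 ((X : A⟦X⟧) • R) = 0 := by
  ext i j
  simp [coeffMat]

theorem coeffMat_succ_X_smul (k : ℕ) (R : Matrix (Fin N) (Fin N) A⟦X⟧) :
    coeffMat (k + 1) ((X : A⟦X⟧) • R) = coeffMat k R := by
  ext i j
  simp [coeffMat]

theorem coeffMat_map_coeffDerivation (k : ℕ) [Algebra ℂ A] (δ : Derivation ℂ A A)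
    (R : Matrix (Fin N) (Fin N) A⟦X⟧) :
    coeffMat k (R.map (coeffDerivation δ)) = (coeffMat k R).map δ := by
  ext i j
  simp [coeffMat]

end PowerSeries

/-! ### Flat connections compatible with a system of coordinates -/

/-- Commuting derivations `∂_α` for which closed forms are exact and only scalars are killed,
coordinates `u^i`, and a flat skew-symmetric connection form `ω` with
`[ω_γ, ∂_α U] = [ω_α, ∂_γ U]`, where `U = diag (u^1, …, u^N)`. -/
structure CoordinateConnection (A : Type*) [CommRing A] [Algebra ℂ A] (N : ℕ) where
  der : Fin N → Derivation ℂ A A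
  der_comm : ∀ α β f, der α (der β f) = der β (der α f)
  exact : ∀ θ : Fin N → A, (∀ α β, der α (θ β) = der β (θ α)) → ∃ f, ∀ α, der α f = θ α
  const : ∀ f, (∀ α, der α f = 0) → ∃ c : ℂ, f = algebraMap ℂ A c
  u : Fin N → A
  inv : Matrix (Fin N) (Fin N) A
  jac_mul_inv : (Matrix.of fun i β => der β (u i)) * inv = 1
  ω : Fin N → Matrix (Fin N) (Fin N) A
  skew : ∀ α, (ω α)ᵀ = -ω α
  flat : ∀ α β, (ω β).map (der α) + ω α * ω β = (ω α).map (der β) + ω β * ω α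
  symm : ∀ α β, ω α * Matrix.diagonal (fun i => der β (u i))
      - Matrix.diagonal (fun i => der β (u i)) * ω α
    = ω β * Matrix.diagonal (fun i => der α (u i))
      - Matrix.diagonal (fun i => der α (u i)) * ω β

namespace CoordinateConnection

open PowerSeries (coeffMat coeffMat_C_mul coeffMat_mul_C coeffMat_ext coeffMat_sub
  coeffMat_zero_X_smul coeffMat_succ_X_smul coeffMat_map_coeffDerivation coeffDerivation
  eulerDerivation evalNegHom)

variable {A : Type*} [CommRing A] [Algebra ℂ A] {N : ℕ} (c : CoordinateConnection A N)

/-- The diagonal matrix `∂_α U`. -/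
def D (α : Fin N) : Matrix (Fin N) (Fin N) A := Matrix.diagonal fun i => c.der α (c.u i)

/-- The covariant derivative `∂_α + ω_α`. -/
def nabla (α : Fin N) (Y : Matrix (Fin N) (Fin N) A) : Matrix (Fin N) (Fin N) A :=
  Y.map (c.der α) + c.ω α * Y

/-- Column i of `inv` is the coordinate field ∂_i. Contracting with it replaces division by ∂_α u^i
- ∂_α u^j, which need not be invertible for any single α. -/
theorem sum_inv_mul_der (i j : Fin N) :
    ∑ β, c.inv β i * c.der β (c.u j) = if i = j then 1 else 0 := by
  have h := congrFun (congrFun c.jac_mul_inv j) i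
  rw [Matrix.mul_apply, Matrix.one_apply] at h
  simp only [Matrix.of_apply] at h
  simp only [mul_comm (c.inv _ _), h, eq_comm (a := i)]

/-- Skewness, with 2 invertible. As a consequence the diagonal of ∇_α applied to a diagonal matrix
is the plain derivative. -/
theorem omega_apply_self (α i : Fin N) : c.ω α i i = 0 := by
  have h := congrFun (congrFun (c.skew α) i) i
  rw [Matrix.transpose_apply, Matrix.neg_apply] at h
  have h2 : (2 : ℂ) • c.ω α i i = 0 := by
    rw [two_smul]
    linear_combination h
  have := congrArg (fun x => (2⁻¹ : ℂ) • x) h2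
  simpa [smul_smul] using this

theorem D_map_comm (α β : Fin N) : (c.D α).map (c.der β) = (c.D β).map (c.der α) := by
  rw [D, D, Derivation.matrix_diagonal, Derivation.matrix_diagonal]
  simp only [c.der_comm β α]

theorem nabla_comm (α β : Fin N) (Y : Matrix (Fin N) (Fin N) A) :
    c.nabla α (c.nabla β Y) = c.nabla β (c.nabla α Y) := by
  have hY : (Y.map (c.der β)).map (c.der α) = (Y.map (c.der α)).map (c.der β) := by
    ext i j
    simp [c.der_comm α β]
  have hf := congrArg (· * Y) (c.flat α β)
  simp only [add_mul] at hf
  simp only [nabla, Derivation.matrix_add, Derivation.matrix_mul, mul_add, hY, ← mul_assoc]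
  rw [← sub_eq_zero] at hf ⊢
  rw [← hf]
  abel

theorem nabla_add (α : Fin N) (X Y : Matrix (Fin N) (Fin N) A) :
    c.nabla α (X + Y) = c.nabla α X + c.nabla α Y := by
  simp only [nabla, Derivation.matrix_add, mul_add]
  abel

/-- Leibniz rule; the correction [ω_β, ∂_α U] X appears because ω multiplies from the left only. -/
theorem nabla_bracket (α β : Fin N) (X : Matrix (Fin N) (Fin N) A) :
    c.nabla β (c.D α * X - X * c.D α) =
      ((c.D α).map (c.der β) * X - X * (c.D α).map (c.der β))
        + (c.D α * c.nabla β X - c.nabla β X * c.D α) + (c.ω β * c.D α - c.D α * c.ω β) * X := by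
  simp only [nabla, Derivation.matrix_sub, Derivation.matrix_mul]
  noncomm_ring

/-- Apply ∇_β to the α-equation and use that ∇_α and ∇_β commute; the terms with ∂_β ∂_α U and [ω_β,
∂_α U] are symmetric in α, β and drop out. For θ = 0 this is the compatibility needed to solve for
off-diagonal entries; for a diagonal defect θ its diagonal says that θ is closed. -/
theorem bracket_nabla_of_nabla_eq {X Y : Matrix (Fin N) (Fin N) A} {θ : Fin N → Fin N → A}
    (h : ∀ α, c.nabla α Y = c.D α * X - X * c.D α + Matrix.diagonal (θ α)) (α β : Fin N) :
    c.D α * c.nabla β X - c.nabla β X * c.D α + c.nabla β (Matrix.diagonal (θ α))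
      = c.D β * c.nabla α X - c.nabla α X * c.D β + c.nabla α (Matrix.diagonal (θ β)) := by
  have hs : (c.ω β * c.D α - c.D α * c.ω β) = (c.ω α * c.D β - c.D β * c.ω α) := c.symm β α
  have h1 := c.nabla_comm α β Y
  rw [h, h, nabla_add, nabla_add, nabla_bracket, nabla_bracket, hs, c.D_map_comm α β] at h1
  rw [← sub_eq_zero] at h1 ⊢
  rw [← neg_eq_zero, ← h1]
  abel

theorem D_bracket_apply (α i j : Fin N) (X : Matrix (Fin N) (Fin N) A) :
    (c.D α * X - X * c.D α) i j = (c.der α (c.u i) - c.der α (c.u j)) * X i j := by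
  rw [Matrix.sub_apply, D, Matrix.diagonal_mul, Matrix.mul_diagonal]
  ring

/-- Off-diagonal solution of `[∂_α U, X] = B_α`. -/
theorem exists_bracket_eq {B : Fin N → Matrix (Fin N) (Fin N) A}
    (h : ∀ α β, c.D α * B β - B β * c.D α = c.D β * B α - B α * c.D β) :
    ∃ X : Matrix (Fin N) (Fin N) A, (∀ i, X i i = 0) ∧
      ∀ α, B α = c.D α * X - X * c.D α + Matrix.diagonal fun i => B α i i := by
  -- For i ≠ j the derivative of u^i - u^j along ∂_i is 1, so contracting (∂_α u^i - ∂_α u^j) X_ij =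
  -- (B_α)_ij with ∂_i forces this value. Compatibility of the B_α shows that it solves the equation
  -- for every α.
  refine ⟨Matrix.of fun i j => if i = j then 0 else ∑ β, c.inv β i * B β i j, by simp, ?_⟩
  intro α
  ext i j
  rw [Matrix.add_apply, D_bracket_apply, Matrix.diagonal_apply, Matrix.of_apply]
  split_ifs with hij
  · rw [hij]; simp
  · have h1 : ∀ β, (c.der α (c.u i) - c.der α (c.u j)) * (c.inv β i * B β i j)
        = c.inv β i * c.der β (c.u i) * B α i j - c.inv β i * c.der β (c.u j) * B α i j := by
      intro β
      have h2 := congrFun (congrFun (h α β) i) j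
      rw [D_bracket_apply, D_bracket_apply] at h2
      linear_combination c.inv β i * h2
    rw [Finset.mul_sum, Finset.sum_congr rfl fun β _ => h1 β, Finset.sum_sub_distrib,
      ← Finset.sum_mul, ← Finset.sum_mul, sum_inv_mul_der, sum_inv_mul_der, if_pos rfl,
      if_neg hij]
    ring

/-- One step of the recursion for the coefficients of a solution. -/
theorem exists_next {X Y : Matrix (Fin N) (Fin N) A}
    (h : ∀ α, c.nabla α X = c.D α * Y - Y * c.D α) (hd : ∀ α i, c.nabla α Y i i = 0) :
    ∃ Z : Matrix (Fin N) (Fin N) A, (∀ α, c.nabla α Y = c.D α * Z - Z * c.D α) ∧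
      ∀ α i, c.nabla α Z i i = 0 := by
  have nabla_zero : ∀ α, c.nabla α (Matrix.diagonal fun _ => 0) = 0 := by
    intro α; ext i j; simp [nabla]
  have h0 : ∀ {X Y : Matrix (Fin N) (Fin N) A},
      (∀ α, c.nabla α X = c.D α * Y - Y * c.D α) → ∀ α β,
      c.D α * c.nabla β Y - c.nabla β Y * c.D α = c.D β * c.nabla α Y - c.nabla α Y * c.D β := by
    intro X Y h α β
    have := c.bracket_nabla_of_nabla_eq (θ := fun _ _ => 0) (X := Y) (Y := X)
      (fun α => by rw [h]; simp) α β
    simpa only [nabla_zero, add_zero] using this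
  obtain ⟨W, hW0, hW⟩ := c.exists_bracket_eq (h0 h)
  have hW' : ∀ α, c.nabla α Y = c.D α * W - W * c.D α := by
    intro α
    have := hW α
    simp only [hd] at this
    rw [this]
    simp
  -- A trial coefficient one step further: it solves the equation up to the diagonal θ of ∇W, and
  -- serves only to show that θ is closed.
  obtain ⟨W2, -, hW2⟩ := c.exists_bracket_eq (h0 hW')
  set θ : Fin N → Fin N → A := fun α i => c.nabla α W i i with hθ
  have hdiag : ∀ (α β i : Fin N), c.nabla α (Matrix.diagonal (θ β)) i i = c.der α (θ β i) := by
    intro α β i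
    simp [nabla, omega_apply_self]
  have hclosed : ∀ i α β, c.der α (θ β i) = c.der β (θ α i) := by
    intro i α β
    have := congrFun (congrFun (c.bracket_nabla_of_nabla_eq hW2 α β) i) i
    rw [Matrix.add_apply, Matrix.add_apply, D_bracket_apply, D_bracket_apply] at this
    simp only [sub_self, zero_mul, zero_add] at this
    rw [← hdiag, ← hdiag]
    exact this.symm
  -- A diagonal summand d does not affect the bracket with ∂_α U; choosing ∂_α d_i = -θ_α,i restores
  -- the invariant for W + d.
  choose d hd' using fun i => c.exact (fun α => -θ α i) (fun α β => by
    rw [map_neg, map_neg, hclosed])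
  refine ⟨W + Matrix.diagonal d, fun α => ?_, fun α i => ?_⟩
  · rw [hW']
    ext i j
    rw [D_bracket_apply, D_bracket_apply, Matrix.add_apply, Matrix.diagonal_apply]
    split_ifs with hij
    · rw [hij]; ring
    · rw [add_zero]
  · rw [nabla_add, Matrix.add_apply]
    have : c.nabla α (Matrix.diagonal d) i i = c.der α (d i) := by
      simp [nabla, omega_apply_self]
    rw [this, hd']
    simp [hθ]

/-- `R` solves `z ∂_α R = [∂_α U, R] - z ω_α R`. -/
def IsSolution (R : Matrix (Fin N) (Fin N) A⟦X⟧) : Prop :=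
  ∀ α, (PowerSeries.X : A⟦X⟧) • R.map (PowerSeries.coeffDerivation (c.der α))
    = (c.D α).map PowerSeries.C * R - R * (c.D α).map PowerSeries.C
      - (PowerSeries.X : A⟦X⟧) • ((c.ω α).map PowerSeries.C * R)

theorem exists_isSolution :
    ∃ R : Matrix (Fin N) (Fin N) A⟦X⟧, c.IsSolution R ∧ coeffMat 0 R = 1 := by
  -- The state is a pair (R_{k-1}, R_k) with the k-th equation and the solvability condition for the
  -- next one; it starts at (R_{-1}, R_0) = (0, 1).
  let P := {p : Matrix (Fin N) (Fin N) A × Matrix (Fin N) (Fin N) A //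
    (∀ α, c.nabla α p.1 = c.D α * p.2 - p.2 * c.D α) ∧ ∀ α i, c.nabla α p.2 i i = 0}
  have hp0 : ∃ p0 : P, p0.1.2 = 1 ∧ p0.1.1 = 0 :=
    ⟨⟨(0, 1), fun α => by simp [nabla], fun α i => by
      simp [nabla, Derivation.matrix_one, omega_apply_self]⟩, rfl, rfl⟩
  have hnext : ∀ p : P, ∃ q : P, q.1.1 = p.1.2 := by
    rintro ⟨⟨X, Y⟩, h1, h2⟩
    obtain ⟨Z, hZ⟩ := c.exists_next h1 h2
    exact ⟨⟨(Y, Z), hZ⟩, rfl⟩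
  choose next hnext using hnext
  obtain ⟨p0, h0, h00⟩ := hp0
  let s : ℕ → P := fun k => Nat.rec p0 (fun _ p => next p) k
  have hs : ∀ k, (s (k + 1)).1.1 = (s k).1.2 := fun k => hnext (s k)
  refine ⟨Matrix.of fun i j => PowerSeries.mk fun k => (s k).1.2 i j, ?_, ?_⟩
  · have hc : ∀ k, coeffMat k (Matrix.of fun i j => PowerSeries.mk fun k => (s k).1.2 i j)
        = (s k).1.2 := by
      intro k
      ext i j
      simp [coeffMat]
    intro α
    apply coeffMat_ext
    intro k
    rw [coeffMat_sub, coeffMat_sub, coeffMat_C_mul, coeffMat_mul_C, hc]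
    cases k with
    | zero =>
      rw [coeffMat_zero_X_smul, coeffMat_zero_X_smul, show (s 0).1.2 = 1 from h0]
      simp
    | succ k =>
      rw [coeffMat_succ_X_smul, coeffMat_succ_X_smul, coeffMat_C_mul,
        coeffMat_map_coeffDerivation, hc, ← (s (k + 1)).2.1 α, hs, nabla]
      abel
  · ext i j
    simpa [coeffMat] using congrFun (congrFun (show (s 0).1.2 = 1 from h0) i) j

end CoordinateConnection

/-! ### Solutions and constant diagonal series -/

namespace PowerSeries

section

variable {A : Type*} [CommRing A] {N : ℕ}

/-- The matrix `Rᵗ(-z)`. -/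
noncomputable def reflect (R : Matrix (Fin N) (Fin N) A⟦X⟧) : Matrix (Fin N) (Fin N) A⟦X⟧ :=
  (R.map evalNegHom)ᵀ

theorem reflect_mul (R R' : Matrix (Fin N) (Fin N) A⟦X⟧) :
    reflect (R * R') = reflect R' * reflect R := by
  rw [reflect, Matrix.map_mul, Matrix.transpose_mul]
  rfl

theorem reflect_reflect (R : Matrix (Fin N) (Fin N) A⟦X⟧) : reflect (reflect R) = R := by
  ext1 i j
  simp [reflect, evalNegHom_evalNegHom]

theorem coeffMat_zero_mul (R R' : Matrix (Fin N) (Fin N) A⟦X⟧) :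
    coeffMat 0 (R * R') = coeffMat 0 R * coeffMat 0 R' := by
  ext i j
  simp [coeffMat, Matrix.mul_apply]

theorem coeffMat_zero_reflect (R : Matrix (Fin N) (Fin N) A⟦X⟧) :
    coeffMat 0 (reflect R) = (coeffMat 0 R)ᵀ := by
  ext i j
  simp [coeffMat, reflect, constantCoeff_evalNegHom]

end

variable {A : Type*} [CommRing A] [Algebra ℂ A] {N : ℕ}

theorem reflect_map_coeffDerivation (δ : Derivation ℂ A A) (R : Matrix (Fin N) (Fin N) A⟦X⟧) :
    reflect (R.map (coeffDerivation δ)) = (reflect R).map (coeffDerivation δ) := by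
  ext1 i j
  simp [reflect, evalNegHom_coeffDerivation]

theorem reflect_map_eulerDerivation (δ : Derivation ℂ A A) (R : Matrix (Fin N) (Fin N) A⟦X⟧) :
    reflect (R.map (eulerDerivation δ)) = (reflect R).map (eulerDerivation δ) := by
  ext1 i j
  simp [reflect, evalNegHom_eulerDerivation]

variable (A) in
/-- The diagonal matrix of series with constant coefficients. -/
noncomputable def constDiag (q : Fin N → ℂ⟦X⟧) : Matrix (Fin N) (Fin N) A⟦X⟧ :=
  Matrix.diagonal fun i => map (algebraMap ℂ A) (q i)

theorem constDiag_mul (q r : Fin N → ℂ⟦X⟧) :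
    constDiag A q * constDiag A r = constDiag A (fun i => q i * r i) := by
  simp [constDiag, Matrix.diagonal_mul_diagonal]

theorem constDiag_one : constDiag A (fun _ : Fin N => 1) = 1 := by
  simp [constDiag]

theorem constDiag_neg (q : Fin N → ℂ⟦X⟧) : constDiag A (fun i => -q i) = -constDiag A q := by
  simp only [constDiag, map_neg, Matrix.diagonal_neg]

theorem reflect_constDiag (q : Fin N → ℂ⟦X⟧) :
    reflect (constDiag A q) = constDiag A fun i => evalNegHom (q i) := by
  rw [reflect, constDiag, Matrix.diagonal_map (map_zero _), Matrix.diagonal_transpose]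
  simp only [evalNegHom_map]
  rfl

theorem constDiag_injective [Nontrivial A] {q r : Fin N → ℂ⟦X⟧}
    (h : constDiag A q = constDiag A r) : q = r := by
  funext i
  have h1 := congrFun (Matrix.diagonal_injective h) i
  exact map_injective _ (algebraMap ℂ A).injective h1

theorem coeffMat_zero_constDiag (q : Fin N → ℂ⟦X⟧) :
    coeffMat 0 (constDiag A q)
      = Matrix.diagonal fun i => algebraMap ℂ A (constantCoeff (q i)) := by
  rw [coeffMat, constDiag, Matrix.diagonal_map (map_zero _)]
  simp

theorem constantCoeff_eq_of_coeffMat_eq [Nontrivial A] {q : Fin N → ℂ⟦X⟧} {c : ℂ}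
    (h : coeffMat 0 (constDiag A q) = Matrix.diagonal fun _ => algebraMap ℂ A c) (i : Fin N) :
    constantCoeff (q i) = c := by
  rw [coeffMat_zero_constDiag] at h
  exact (algebraMap ℂ A).injective (congrFun (Matrix.diagonal_injective h) i)

theorem constDiag_map_coeffDerivation (δ : Derivation ℂ A A) (q : Fin N → ℂ⟦X⟧) :
    (constDiag A q).map (coeffDerivation δ) = 0 := by
  rw [constDiag, Derivation.matrix_diagonal, ← Matrix.diagonal_zero]
  congr 1
  funext i
  ext k
  simp

theorem constDiag_map_eulerDerivation (δ : Derivation ℂ A A) (q : Fin N → ℂ⟦X⟧) :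
    (constDiag A q).map (eulerDerivation δ) = constDiag A fun i => X * d⁄dX ℂ (q i) := by
  rw [constDiag, Derivation.matrix_diagonal, constDiag]
  congr 1
  funext i
  ext k
  rw [coeff_eulerDerivation, coeff_map, coeff_map, Derivation.map_algebraMap, add_zero]
  cases k with
  | zero => simp
  | succ k =>
    rw [coeff_succ_X_mul, coeff_derivative]
    simp [mul_comm]

end PowerSeries

namespace CoordinateConnection

open PowerSeries

variable {A : Type*} [CommRing A] [Algebra ℂ A] {N : ℕ} {c : CoordinateConnection A N}
  {R R' : Matrix (Fin N) (Fin N) A⟦X⟧}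

/-- Contract with ∂_i, along which u^i - u^j has derivative 1. -/
theorem eq_zero_of_der_sub_mul {i j : Fin N} (hij : i ≠ j) {x : A}
    (h : ∀ α, (c.der α (c.u i) - c.der α (c.u j)) * x = 0) : x = 0 := by
  have h1 : ∑ β, (c.inv β i * c.der β (c.u i) - c.inv β i * c.der β (c.u j)) * x = 0 :=
    Finset.sum_eq_zero fun β _ => by linear_combination c.inv β i * h β
  rw [← Finset.sum_mul, Finset.sum_sub_distrib, sum_inv_mul_der, sum_inv_mul_der, if_pos rfl,
    if_neg hij] at h1
  simpa using h1

/-- The sign change of z and the skewness of ω compensate: Rᵗ(-z) obeys the same equation as R(z)⁻¹.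
-/
theorem IsSolution.reflect (h : c.IsSolution R) (α : Fin N) :
    (X : A⟦X⟧) • (reflect R).map (coeffDerivation (c.der α))
      = (c.D α).map C * reflect R - reflect R * (c.D α).map C
        + (X : A⟦X⟧) • (reflect R * (c.ω α).map C) := by
  have h1 := congrArg PowerSeries.reflect (h α)
  have hX : ∀ Y : Matrix (Fin N) (Fin N) A⟦X⟧,
      PowerSeries.reflect ((X : A⟦X⟧) • Y) = -((X : A⟦X⟧) • PowerSeries.reflect Y) := by
    intro Y; ext1 i j; simp [PowerSeries.reflect]
  have hsub : ∀ Y Z : Matrix (Fin N) (Fin N) A⟦X⟧,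
      PowerSeries.reflect (Y - Z) = PowerSeries.reflect Y - PowerSeries.reflect Z := by
    intro Y Z; ext1 i j; simp [PowerSeries.reflect]
  have hC : ∀ Y : Matrix (Fin N) (Fin N) A,
      PowerSeries.reflect (Y.map C) = Yᵀ.map C := by
    intro Y; ext1 i j; ext k
    simp only [PowerSeries.reflect, Matrix.transpose_apply, Matrix.map_apply, coeff_evalNegHom,
      coeff_C]
    split_ifs with hk <;> simp [hk]
  have hneg : (-c.ω α).map (C : A →+* A⟦X⟧) = -(c.ω α).map C := by
    ext1 i j; simp
  have hD : (c.D α)ᵀ = c.D α := Matrix.diagonal_transpose _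
  rw [hX, reflect_map_coeffDerivation, hsub, hsub, hX, reflect_mul, reflect_mul, reflect_mul, hC,
    hC, hD, c.skew, hneg] at h1
  rw [mul_neg, smul_neg] at h1
  rw [← neg_inj, h1]
  abel

/-- The two ω-terms cancel, as they would for R⁻¹R'. -/
theorem IsSolution.smul_map_reflect_mul (h : c.IsSolution R) (h' : c.IsSolution R')
    (α : Fin N) :
    (X : A⟦X⟧) • (PowerSeries.reflect R * R').map (coeffDerivation (c.der α))
      = (c.D α).map C * (PowerSeries.reflect R * R')
        - (PowerSeries.reflect R * R') * (c.D α).map C := by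
  rw [Derivation.matrix_mul, smul_add, ← smul_mul_assoc, ← mul_smul_comm, h.reflect, h' α]
  simp only [mul_sub, add_mul, sub_mul, smul_mul_assoc, mul_smul_comm, mul_assoc]
  abel

/-- `Rᵗ(-z) R'(z)` is a constant diagonal matrix for any two solutions. -/
theorem IsSolution.exists_reflect_mul_eq (h : c.IsSolution R) (h' : c.IsSolution R') :
    ∃ q : Fin N → ℂ⟦X⟧, PowerSeries.reflect R * R' = constDiag A q := by
  set Q := PowerSeries.reflect R * R' with hQ
  have hk : ∀ α k i j, (c.der α (c.u i) - c.der α (c.u j)) * coeffMat (k + 1) Q i j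
      = c.der α (coeffMat k Q i j) := by
    intro α k i j
    have := congrArg (coeffMat (k + 1)) (h.smul_map_reflect_mul h' α)
    rw [coeffMat_succ_X_smul, coeffMat_sub, coeffMat_C_mul, coeffMat_mul_C,
      coeffMat_map_coeffDerivation] at this
    rw [← D_bracket_apply, ← this, Matrix.map_apply]
  have h0 : ∀ α i j, (c.der α (c.u i) - c.der α (c.u j)) * coeffMat 0 Q i j = 0 := by
    intro α i j
    have := congrArg (coeffMat 0) (h.smul_map_reflect_mul h' α)
    rw [coeffMat_zero_X_smul, coeffMat_sub, coeffMat_C_mul, coeffMat_mul_C] at this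
    rw [← D_bracket_apply, ← this, Matrix.zero_apply]
  -- If the off-diagonal entries of Q_k vanish, so do their derivatives, and hence the off-diagonal
  -- entries of Q_{k+1}. On the diagonal the bracket is zero, so all derivatives vanish.
  have hoff : ∀ k i j, i ≠ j → coeffMat k Q i j = 0 := by
    intro k
    induction k with
    | zero => exact fun i j hij => eq_zero_of_der_sub_mul (c := c) hij fun α => h0 α i j
    | succ k ih =>
      intro i j hij
      refine eq_zero_of_der_sub_mul (c := c) hij fun α => ?_
      rw [hk, ih i j hij, map_zero]
  have hconst : ∀ k i, ∃ a : ℂ, coeffMat k Q i i = algebraMap ℂ A a := by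
    intro k i
    refine c.const _ fun α => ?_
    rw [← hk, sub_self, zero_mul]
  choose a ha using hconst
  refine ⟨fun i => PowerSeries.mk fun k => a k i, coeffMat_ext fun k => ?_⟩
  ext i j
  rw [coeffMat, coeffMat, constDiag, Matrix.diagonal_map (map_zero _), Matrix.diagonal_apply]
  split_ifs with hij
  · subst hij
    simpa [coeffMat] using ha k i
  · exact hoff k i j hij

/-- Constant diagonal matrices are annihilated by ∂_α and commute with ∂_α U. -/
theorem IsSolution.mul_constDiag (h : c.IsSolution R) (q : Fin N → ℂ⟦X⟧) :
    c.IsSolution (R * constDiag A q) := by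
  intro α
  have hc : constDiag A q * (c.D α).map C = (c.D α).map C * constDiag A q := by
    rw [D, Matrix.diagonal_map (map_zero _), constDiag, Matrix.diagonal_mul_diagonal,
      Matrix.diagonal_mul_diagonal]
    simp only [mul_comm]
  rw [Derivation.matrix_mul, constDiag_map_coeffDerivation, mul_zero, add_zero,
    ← smul_mul_assoc, h α, mul_assoc R, hc]
  simp only [sub_mul, smul_mul_assoc, mul_assoc]

variable [Nontrivial A]

/-- For any normalized solution, Q = Rᵗ(-z)R(z) is constant diagonal, is fixed by the reflection and
hence even, and starts with 1. Right multiplication by its even inverse square root makes Q equal to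
1. -/
theorem exists_isSolution_unitary (c : CoordinateConnection A N) :
    ∃ R : Matrix (Fin N) (Fin N) A⟦X⟧, c.IsSolution R ∧ coeffMat 0 R = 1 ∧
      R * reflect R = 1 := by
  obtain ⟨R, hR, hR0⟩ := c.exists_isSolution
  obtain ⟨q, hq⟩ := hR.exists_reflect_mul_eq hR
  have hq1 : ∀ i, constantCoeff (q i) = 1 := by
    refine constantCoeff_eq_of_coeffMat_eq (A := A) ?_
    rw [← hq, coeffMat_zero_mul, coeffMat_zero_reflect, hR0]
    simp
  have hqe : ∀ i, evalNegHom (q i) = q i := by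
    refine congrFun (constDiag_injective (A := A) ?_)
    rw [← reflect_constDiag, ← hq, reflect_mul, reflect_reflect]
  choose T hT1 hT using fun i => exists_mul_evalNegHom_mul_eq_one (hq1 i) (hqe i)
  refine ⟨R * constDiag A T, hR.mul_constDiag T, ?_, ?_⟩
  · rw [coeffMat_zero_mul, hR0, coeffMat_zero_constDiag]
    simp [hT1]
  · rw [mul_eq_one_comm, reflect_mul, mul_assoc, ← mul_assoc _ R, hq, reflect_constDiag,
      constDiag_mul, constDiag_mul, ← constDiag_one]
    congr 1
    funext i
    rw [← mul_assoc, hT]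

/-- Unitarity of R gives R' = Rq with q = Rᵗ(-z)R' constant diagonal and q(0) = 1. Writing q = exp
b, unitarity of R' is q(z)q(-z) = 1, which means that b is odd. -/
theorem isSolution_unitary_iff (h : c.IsSolution R) (h0 : coeffMat 0 R = 1)
    (hu : R * reflect R = 1) :
    (c.IsSolution R' ∧ coeffMat 0 R' = 1 ∧ R' * reflect R' = 1) ↔
      ∃ a : ℕ → Fin N → ℂ, R' = R * constDiag A fun i => (exp ℂ).subst
        (PowerSeries.mk fun m => if Odd m then a (m / 2) i else 0 : ℂ⟦X⟧) := by
  constructor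
  · rintro ⟨h', h0', hu'⟩
    obtain ⟨q, hq⟩ := h.exists_reflect_mul_eq h'
    have hR' : R' = R * constDiag A q := by rw [← hq, ← mul_assoc, hu, one_mul]
    have hq1 : ∀ i, constantCoeff (q i) = 1 := by
      refine constantCoeff_eq_of_coeffMat_eq (A := A) ?_
      rw [← hq, coeffMat_zero_mul, coeffMat_zero_reflect, h0, h0']
      simp
    choose b hb hbq using fun i => exists_exp_subst_eq (hq1 i)
    have hqq : ∀ i, q i * evalNegHom (q i) = 1 := by
      refine congrFun (constDiag_injective (A := A) ?_)
      rw [← constDiag_mul, ← reflect_constDiag, constDiag_one, mul_eq_one_comm, ← hq,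
        reflect_mul, reflect_reflect, mul_assoc, ← mul_assoc R, hu, one_mul,
        ← mul_eq_one_comm, hu']
    have hodd : ∀ i, ∃ a : ℕ → ℂ, b i = PowerSeries.mk fun m => if Odd m then a (m / 2) else 0 := by
      intro i
      rw [← evalNegHom_eq_neg_iff, ← exp_subst_mul_evalNegHom_eq_one_iff (hb i), hbq, hqq]
    choose a ha using hodd
    refine ⟨fun k i => a i k, ?_⟩
    rw [hR']
    congr 2
    funext i
    rw [← hbq, ha]
  · rintro ⟨a, rfl⟩
    have hb : ∀ i, constantCoeff
        (PowerSeries.mk fun m => if Odd m then a (m / 2) i else 0 : ℂ⟦X⟧) = 0 := fun i => by simp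
    obtain ⟨T, hTe⟩ : ∃ T : Fin N → ℂ⟦X⟧, (fun i => (exp ℂ).subst
        (PowerSeries.mk fun m => if Odd m then a (m / 2) i else 0 : ℂ⟦X⟧)) = T := ⟨_, rfl⟩
    have hT1 : ∀ i, constantCoeff (T i) = 1 := fun i => by
      rw [← hTe]
      exact constantCoeff_exp_subst (hb i)
    have hT : ∀ i, T i * evalNegHom (T i) = 1 := fun i => by
      rw [← hTe]
      exact (exp_subst_mul_evalNegHom_eq_one_iff (hb i)).mpr
        (evalNegHom_eq_neg_iff.mpr ⟨fun k => a k i, rfl⟩)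
    rw [hTe]
    refine ⟨h.mul_constDiag _, ?_, ?_⟩
    · rw [coeffMat_zero_mul, h0, coeffMat_zero_constDiag]
      simp only [hT1, map_one, Matrix.diagonal_one, mul_one]
    · rw [reflect_mul, mul_assoc, ← mul_assoc (constDiag A _), reflect_constDiag, constDiag_mul]
      simp only [hT]
      rw [constDiag_one, one_mul, hu]

end CoordinateConnection

/-! ### Homogeneous solutions -/

namespace CoordinateConnection

open PowerSeries

variable {A : Type*} [CommRing A] [Algebra ℂ A] {N : ℕ} {c : CoordinateConnection A N}
  {R R' : Matrix (Fin N) (Fin N) A⟦X⟧}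

/-- A derivation `ε` is homogeneous if `L_ε dU = dU` and `L_ε ω = 0`; here
`[∂_α, ε] = ∑ M_αβ ∂_β`. -/
structure IsHomogeneousDerivation (c : CoordinateConnection A N) (ε : Derivation ℂ A A)
    (M : Matrix (Fin N) (Fin N) A) : Prop where
  der_comm : ∀ α f, ε (c.der α f) = c.der α (ε f) - ∑ β, M α β * c.der β f
  der_u : ∀ α i, ε (c.der α (c.u i)) = c.der α (c.u i) - ∑ β, M α β * c.der β (c.u i)
  map_ω : ∀ α, (c.ω α).map ε = -∑ β, M α β • c.ω β

variable {ε : Derivation ℂ A A} {M : Matrix (Fin N) (Fin N) A}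

/-- Apply L = z d/dz + ε to the equation. Both z and dU have weight one and ω has weight zero, so
the extra undifferentiated terms reproduce the equation for R, while the terms with M combine into
the equations in the directions β. -/
theorem IsSolution.map_eulerDerivation (hε : c.IsHomogeneousDerivation ε M)
    (h : c.IsSolution R) : c.IsSolution (R.map (eulerDerivation ε)) := by
  intro α
  have hXL : ∀ Y : Matrix (Fin N) (Fin N) A⟦X⟧, ((X : A⟦X⟧) • Y).map (eulerDerivation ε)
      = (X : A⟦X⟧) • Y + (X : A⟦X⟧) • Y.map (eulerDerivation ε) := by
    intro Y
    ext1 i j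
    simp only [Matrix.map_apply, Matrix.smul_apply, Matrix.add_apply, smul_eq_mul,
      Derivation.leibniz, eulerDerivation_X]
    ring
  have h1 : (R.map (coeffDerivation (c.der α))).map (eulerDerivation ε)
      = (R.map (eulerDerivation ε)).map (coeffDerivation (c.der α))
        - ∑ β, (C (M α β) : A⟦X⟧) • R.map (coeffDerivation (c.der β)) := by
    ext i j k
    simp only [Matrix.map_apply, Matrix.sub_apply, Matrix.sum_apply, Matrix.smul_apply,
      smul_eq_mul, map_sub, map_sum, coeff_eulerDerivation, coeff_coeffDerivation, coeff_C_mul,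
      hε.der_comm, map_add, Derivation.leibniz, Derivation.map_natCast]
    ring
  have h2 : ((c.D α).map C).map (eulerDerivation ε)
      = (c.D α).map C - ∑ β, (C (M α β) : A⟦X⟧) • (c.D β).map C := by
    ext1 i j
    simp only [Matrix.map_apply, Matrix.sub_apply, Matrix.sum_apply, Matrix.smul_apply,
      smul_eq_mul, eulerDerivation_C, D, Matrix.diagonal_apply]
    split_ifs <;> simp [hε.der_u]
  have h3 : ((c.ω α).map C).map (eulerDerivation ε)
      = -∑ β, (C (M α β) : A⟦X⟧) • (c.ω β).map C := by
    ext1 i j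
    have := congrFun (congrFun (hε.map_ω α) i) j
    simp only [Matrix.map_apply, Matrix.neg_apply, Matrix.sum_apply, Matrix.smul_apply,
      smul_eq_mul] at this ⊢
    rw [eulerDerivation_C, this]
    simp
  have hS : (X : A⟦X⟧) • ∑ β, (C (M α β) : A⟦X⟧) • R.map (coeffDerivation (c.der β))
      = (∑ β, (C (M α β) : A⟦X⟧) • (c.D β).map C) * R
        - R * (∑ β, (C (M α β) : A⟦X⟧) • (c.D β).map C)
        - (X : A⟦X⟧) • ((∑ β, (C (M α β) : A⟦X⟧) • (c.ω β).map C) * R) := by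
    rw [Finset.smul_sum, Finset.sum_mul, Finset.mul_sum, Finset.sum_mul, Finset.smul_sum,
      ← Finset.sum_sub_distrib, ← Finset.sum_sub_distrib]
    refine Finset.sum_congr rfl fun β _ => ?_
    rw [smul_comm, h β, smul_sub, smul_sub, smul_mul_assoc, mul_smul_comm, smul_mul_assoc,
      smul_comm (X : A⟦X⟧)]
  have h4 := congrArg (fun Y : Matrix (Fin N) (Fin N) A⟦X⟧ => Y.map (eulerDerivation ε)) (h α)
  simp only [Derivation.matrix_sub, Derivation.matrix_mul, hXL] at h4
  rw [h1, h2, h3, h α, smul_sub, hS] at h4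
  simp only [smul_add, sub_mul, mul_sub, neg_mul, smul_neg] at h4
  rw [← sub_eq_zero] at h4 ⊢
  rw [← h4]
  abel

/-- The product is a constant diagonal matrix q with z q' = 0, so it equals its constant term. For
R' = R this is unitarity; for two different solutions it is uniqueness. -/
theorem IsSolution.reflect_mul_eq_one_of_homogeneous [Nontrivial A] (h : c.IsSolution R)
    (h' : c.IsSolution R') (h0 : coeffMat 0 R = 1) (h0' : coeffMat 0 R' = 1)
    (hL : R.map (eulerDerivation ε) = 0) (hL' : R'.map (eulerDerivation ε) = 0) :
    PowerSeries.reflect R * R' = 1 := by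
  obtain ⟨q, hq⟩ := h.exists_reflect_mul_eq h'
  have hq1 : ∀ i, constantCoeff (q i) = 1 := by
    refine constantCoeff_eq_of_coeffMat_eq (A := A) ?_
    rw [← hq, coeffMat_zero_mul, coeffMat_zero_reflect, h0, h0']
    simp
  have hr0 : PowerSeries.reflect (0 : Matrix (Fin N) (Fin N) A⟦X⟧) = 0 := by
    ext1 i j
    simp [PowerSeries.reflect]
  have hd : ∀ i, X * d⁄dX ℂ (q i) = 0 := by
    refine congrFun (constDiag_injective (A := A) (r := fun _ => 0) ?_)
    rw [← constDiag_map_eulerDerivation ε, ← hq, Derivation.matrix_mul,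
      ← reflect_map_eulerDerivation, hL, hL', hr0]
    simp [constDiag]
  have : q = fun _ => 1 := by
    funext i
    refine derivative.ext (R := ℂ) ?_ (by rw [hq1, map_one])
    rw [derivative_one]
    exact (mul_eq_zero.mp (hd i)).resolve_left X_ne_zero
  rw [hq, this, constDiag_one]

theorem exists_isSolution_homogeneous [Nontrivial A] (hε : c.IsHomogeneousDerivation ε M) :
    ∃ R : Matrix (Fin N) (Fin N) A⟦X⟧, c.IsSolution R ∧ coeffMat 0 R = 1 ∧
      R * reflect R = 1 ∧ R.map (eulerDerivation ε) = 0 ∧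
      ∀ R' : Matrix (Fin N) (Fin N) A⟦X⟧, c.IsSolution R' → coeffMat 0 R' = 1 →
        R'.map (eulerDerivation ε) = 0 → R' = R := by
  obtain ⟨R, hR, hR0, hu⟩ := exists_isSolution_unitary c
  -- The comparison of two solutions does not require constant term 1, so it applies to LR, whose
  -- constant term is 0.
  obtain ⟨q, hq⟩ := hR.exists_reflect_mul_eq (hR.map_eulerDerivation hε)
  have hLR : R.map (eulerDerivation ε) = R * constDiag A q := by
    rw [← hq, ← mul_assoc, hu, one_mul]
  have hL0 : coeffMat 0 (R.map (eulerDerivation ε)) = 0 := by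
    ext i j
    have := congrFun (congrFun (congrArg (fun Y : Matrix (Fin N) (Fin N) A => Y.map ε) hR0) i) j
    simp only [Derivation.matrix_one] at this
    simp only [coeffMat, Matrix.map_apply, coeff_eulerDerivation] at this ⊢
    rw [this]
    simp
  have hq0 : ∀ i, constantCoeff (q i) = 0 := by
    refine constantCoeff_eq_of_coeffMat_eq (A := A) ?_
    rw [← hq, coeffMat_zero_mul, hL0]
    simp
  choose T hT1 hT using fun i => exists_X_mul_derivative_eq (hq0 i)
  have hS := hR.mul_constDiag T
  have hS0 : coeffMat 0 (R * constDiag A T) = 1 := by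
    rw [coeffMat_zero_mul, hR0, coeffMat_zero_constDiag]
    simp [hT1]
  have hSL : (R * constDiag A T).map (eulerDerivation ε) = 0 := by
    rw [Derivation.matrix_mul, hLR, constDiag_map_eulerDerivation]
    simp only [hT]
    rw [constDiag_neg, ← constDiag_mul, mul_neg, mul_assoc, add_neg_cancel]
  have hSu := mul_eq_one_comm.mp (hS.reflect_mul_eq_one_of_homogeneous hS hS0 hS0 hSL hSL)
  refine ⟨_, hS, hS0, hSu, hSL, fun R' h' h0' hL' => ?_⟩
  rw [← one_mul R', ← hSu, mul_assoc, hS.reflect_mul_eq_one_of_homogeneous h' hS0 h0' hSL hL',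
    mul_one]

end CoordinateConnection

/-! ### Primitives of analytic forms are analytic -/

section Primitive

open FormalMultilinearSeries Filter Topology

variable {E : Type*} [NormedAddCommGroup E] [NormedSpace ℂ E]

/-- The series `∑ pₙ / (n + 1)`. -/
noncomputable def scaledSeries (p : FormalMultilinearSeries ℂ E (E →L[ℂ] ℂ)) :
    FormalMultilinearSeries ℂ E (E →L[ℂ] ℂ) := fun n => ((n + 1 : ℂ)⁻¹) • p n

theorem scaledSeries_apply (p : FormalMultilinearSeries ℂ E (E →L[ℂ] ℂ)) (n : ℕ) (v : Fin n → E)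
    (y : E) : scaledSeries p n v y = (n + 1 : ℂ)⁻¹ * p n v y := rfl

/-- Restricted to a ray, τ ↦ f(τy) is holomorphic with derivative w(τy)y = ∑ τⁿ pₙ(y,…,y)y. Its
Taylor series at τ = 1 therefore sums to f(y) with terms pₙ(y,…,y)y/(n + 1), for which only
one-variable theory is needed. -/
theorem hasFPowerSeriesOnBall_of_hasFDerivAt {f : E → ℂ} {w : E → E →L[ℂ] ℂ}
    {p : FormalMultilinearSeries ℂ E (E →L[ℂ] ℂ)} {r : ℝ} (hr : 0 < r)
    (hw : HasFPowerSeriesOnBall w p 0 (ENNReal.ofReal r))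
    (hf : ∀ y, ‖y‖ < r → HasFDerivAt f (w y) y) :
    HasFPowerSeriesOnBall f (unshift (scaledSeries p) (f 0)) 0
      (ENNReal.ofReal r) where
  r_le := by
    rw [radius_unshift]
    refine hw.r_le.trans (radius_le_of_le fun n => ?_)
    rw [scaledSeries, norm_smul]
    refine mul_le_of_le_one_left (norm_nonneg _) ?_
    rw [norm_inv]
    refine inv_le_one_of_one_le₀ ?_
    have : ((n : ℂ) + 1) = ((n + 1 : ℕ) : ℂ) := by push_cast; rfl
    rw [this, Complex.norm_natCast]
    exact_mod_cast Nat.le_add_left 1 n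
  r_pos := ENNReal.ofReal_pos.mpr hr
  hasSum := by
    intro y hy
    have hy' : ‖y‖ < r := by
      rw [Metric.mem_eball, edist_zero_right, ← ofReal_norm,
        ENNReal.ofReal_lt_ofReal_iff hr] at hy
      exact hy
    set u : ℂ →L[ℂ] E := (ContinuousLinearMap.id ℂ ℂ).smulRight y with hu
    have hut : ∀ τ, u τ = τ • y := fun τ => by simp [hu]
    -- This radius satisfies ρ > 1 and ρ‖y‖ < r, including the case y = 0, where r/‖y‖ would be
    -- unavailable.
    set ρ : ℝ := 2 * r / (r + ‖y‖) with hρ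
    have hy0 := norm_nonneg y
    have hρ1 : 1 < ρ := by
      rw [hρ, one_lt_div (by linarith)]
      linarith
    have hball : ∀ τ ∈ Metric.ball (0 : ℂ) ρ, ‖τ • y‖ < r := by
      intro τ hτ
      rw [mem_ball_zero_iff, hρ, lt_div_iff₀ (by linarith)] at hτ
      rw [norm_smul]
      have hτ0 := norm_nonneg τ
      nlinarith
    have hder : ∀ τ ∈ Metric.ball (0 : ℂ) ρ, HasDerivAt (fun τ => f (u τ)) (w (u τ) y) τ := by
      intro τ hτ
      have h1 := (hf (u τ) (by rw [hut]; exact hball τ hτ)).comp τ u.hasFDerivAt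
      have h2 := h1.hasDerivAt
      have h3 : w (u τ) y = (w (u τ) ∘L u) 1 := by simp [hut]
      rw [h3]
      exact h2
    have hsum := Complex.hasSum_taylorSeries_on_ball (f := fun τ => f (u τ)) (c := 0) (r := ρ)
      (fun τ hτ => (hder τ hτ).differentiableAt.differentiableWithinAt) (z := 1)
      (by rw [mem_ball_zero_iff, norm_one]; exact hρ1)
    have hψ : ∀ n : ℕ, iteratedDeriv n (fun τ => w (u τ) y) 0
        = (n.factorial : ℂ) * p n (fun _ => y) y := by
      intro n
      have hw0 : HasFPowerSeriesOnBall w p (u 0) (ENNReal.ofReal r) := by rwa [map_zero]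
      have h1 := (ContinuousLinearMap.apply ℂ ℂ y).comp_hasFPowerSeriesOnBall
        hw0.compContinuousLinearMap
      have h2 := h1.factorial_smul (y := 1) n
      rw [iteratedDeriv_eq_iteratedFDeriv]
      refine Eq.trans h2.symm ?_
      rw [nsmul_eq_mul]
      congr 1
      simp only [ContinuousLinearMap.compFormalMultilinearSeries_apply,
        ContinuousLinearMap.compContinuousMultilinearMap_coe, Function.comp_apply,
        FormalMultilinearSeries.compContinuousLinearMap_apply, ContinuousLinearMap.apply_apply]
      congr 2
      funext i
      simp [hut]
    have hd : deriv (fun τ => f (u τ)) =ᶠ[𝓝 0] fun τ => w (u τ) y := by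
      filter_upwards [Metric.ball_mem_nhds (0 : ℂ) (by linarith : 0 < ρ)] with τ hτ
      exact (hder τ hτ).deriv
    have e1 : f (0 + y) = f (u 1) := by rw [hut, zero_add, one_smul]
    rw [e1]
    convert hsum using 1
    funext n
    cases n with
    | zero => simp [unshift]
    | succ n =>
      rw [iteratedDeriv_succ', hd.iteratedDeriv_eq n, hψ]
      have hn : ((n : ℂ) + 1) ≠ 0 := by exact_mod_cast n.succ_ne_zero
      have hn' : (n.factorial : ℂ) ≠ 0 := by exact_mod_cast n.factorial_ne_zero
      simp only [unshift, Nat.succ_eq_add_one,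
        continuousMultilinearCurryRightEquiv_symm_apply', sub_zero, one_pow, scaledSeries_apply,
        smul_eq_mul, Nat.factorial_succ]
      push_cast
      rw [show (Fin.init fun _ : Fin (n + 1) => y) = fun _ => y from rfl]
      field_simp

/-- Translate to the origin and integrate the power series of w on a ball of finite radius inside
both domains. This upgrades the primitives from the Poincaré lemma to analytic functions. -/
theorem AnalyticAt.of_hasFDerivAt {f : E → ℂ} {w : E → E →L[ℂ] ℂ} {x : E}
    (hw : AnalyticAt ℂ w x) (hf : ∀ᶠ y in 𝓝 x, HasFDerivAt f (w y) y) : AnalyticAt ℂ f x := by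
  have hw0 : AnalyticAt ℂ (fun y => w (x + y)) 0 :=
    AnalyticAt.fun_comp (g := w) (f := fun y => x + y) (by simpa using hw)
      (analyticAt_const.add analyticAt_id)
  obtain ⟨p, r, hp⟩ := hw0
  obtain ⟨s, hs, hsf⟩ := Metric.eventually_nhds_iff.mp hf
  obtain ⟨r', hr', hr'r⟩ : ∃ r' : ℝ, 0 < r' ∧ ENNReal.ofReal r' ≤ r ∧ r' ≤ s := by
    by_cases h : r ≤ ENNReal.ofReal s
    · have hrt : r ≠ ⊤ := ne_top_of_le_ne_top ENNReal.ofReal_ne_top h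
      refine ⟨r.toReal, ENNReal.toReal_pos hp.r_pos.ne' hrt, by rw [ENNReal.ofReal_toReal hrt], ?_⟩
      exact ENNReal.toReal_le_of_le_ofReal hs.le h
    · exact ⟨s, hs, (not_le.mp h).le, le_rfl⟩
  have h1 := hasFPowerSeriesOnBall_of_hasFDerivAt (f := fun y => f (x + y)) hr'
    (hp.mono (ENNReal.ofReal_pos.mpr hr') hr'r.1) (fun y hy => by
      have h2 : HasFDerivAt f (w (x + y)) (x + y) :=
        hsf (by rw [dist_eq_norm, add_sub_cancel_left]; exact hy.trans_le hr'r.2)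
      have h3 := h2.comp y ((hasFDerivAt_id y).const_add x)
      rwa [ContinuousLinearMap.comp_id] at h3)
  have h3 : AnalyticAt ℂ (fun y => f (x + y)) (x - x) := by
    rw [sub_self]
    exact ⟨_, _, h1⟩
  have h4 := AnalyticAt.fun_comp (g := fun y => f (x + y)) (f := fun y => y - x) h3
    (analyticAt_id.sub analyticAt_const)
  simpa [Function.comp_def] using h4

end Primitive

/-! ### The algebra of holomorphic functions -/

/-- The algebra of holomorphic functions on `V`. -/
def Hol {N : ℕ} (V : Set (Pt N)) : Subalgebra ℂ (V → ℂ) where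
  carrier := {f | ∃ F : Pt N → ℂ, AnalyticOnNhd ℂ F V ∧ ∀ t : V, f t = F t}
  mul_mem' := by
    rintro f g ⟨F, hF, hf⟩ ⟨G, hG, hg⟩
    exact ⟨F * G, hF.mul hG, fun t => by simp [hf, hg]⟩
  add_mem' := by
    rintro f g ⟨F, hF, hf⟩ ⟨G, hG, hg⟩
    exact ⟨F + G, hF.add hG, fun t => by simp [hf, hg]⟩
  algebraMap_mem' c := ⟨fun _ => c, analyticOnNhd_const, fun t => rfl⟩

namespace Hol

variable {N : ℕ} {V : Set (Pt N)}

/-- The class of a function which is analytic on `V`. -/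
def mk (F : Pt N → ℂ) (hF : AnalyticOnNhd ℂ F V) : Hol V := ⟨fun t => F t, F, hF, fun _ => rfl⟩

/-- A function on the ambient space restricting to `f`. -/
noncomputable def rep (f : Hol V) : Pt N → ℂ := f.2.choose

theorem analyticOnNhd_rep (f : Hol V) : AnalyticOnNhd ℂ (rep f) V := f.2.choose_spec.1

/-- Evaluation at a point. -/
def ev (t : V) : Hol V →ₐ[ℂ] ℂ := (Pi.evalAlgHom ℂ (fun _ : V => ℂ) t).comp (Hol V).val

theorem ev_eq_rep (f : Hol V) (t : V) : ev t f = rep f t := f.2.choose_spec.2 t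

@[simp]
theorem ev_mk (F : Pt N → ℂ) (hF : AnalyticOnNhd ℂ F V) (t : V) : ev t (mk F hF) = F t := rfl

theorem ext_ev {f g : Hol V} (h : ∀ t : V, ev t f = ev t g) : f = g :=
  Subtype.ext (funext h)

theorem isUnit_of_ev_ne_zero {f : Hol V} (h : ∀ t : V, ev t f ≠ 0) : IsUnit f := by
  have hF : AnalyticOnNhd ℂ (rep f)⁻¹ V := fun t ht =>
    (analyticOnNhd_rep f t ht).inv (by rw [← ev_eq_rep f ⟨t, ht⟩]; exact h _)
  refine IsUnit.of_mul_eq_one (mk _ hF) (ext_ev fun t => ?_)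
  rw [map_mul, ev_mk, map_one, Pi.inv_apply, ← ev_eq_rep, mul_inv_cancel₀ (h t)]

theorem _root_.AnalyticOnNhd.fderiv_apply {F : Pt N → ℂ} (hF : AnalyticOnNhd ℂ F V) (v : Pt N) :
    AnalyticOnNhd ℂ (fun t => fderiv ℂ F t v) V :=
  (ContinuousLinearMap.apply ℂ ℂ v).comp_analyticOnNhd hF.fderiv

/-- The derivative in the direction `v`. -/
noncomputable def derFun (v : Pt N) (f : Hol V) : Hol V :=
  mk (fun t => fderiv ℂ (rep f) t v) ((analyticOnNhd_rep f).fderiv_apply v)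

/-- On the open set V two representatives agree near every point, so the choice made by `rep` does
not matter. -/
theorem ev_derFun (hV : IsOpen V) (v : Pt N) {f : Hol V} {F : Pt N → ℂ}
    (h : ∀ t : V, ev t f = F t) (t : V) : ev t (derFun v f) = fderiv ℂ F t v := by
  rw [derFun, ev_mk]
  have : rep f =ᶠ[nhds (t : Pt N)] F := by
    filter_upwards [hV.mem_nhds t.2] with x hx
    rw [← ev_eq_rep f ⟨x, hx⟩, h]
  rw [this.fderiv_eq]

/-- The derivation in the direction `v`. -/
noncomputable def der (hV : IsOpen V) (v : Pt N) : Derivation ℂ (Hol V) (Hol V) :=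
  Derivation.mk'
    { toFun := derFun v
      map_add' := fun f g => by
        refine ext_ev fun t => ?_
        have hf := (analyticOnNhd_rep f t t.2).differentiableAt
        have hg := (analyticOnNhd_rep g t t.2).differentiableAt
        rw [map_add, ev_derFun hV v (F := rep f + rep g)
            (fun t => by rw [map_add, ev_eq_rep f, ev_eq_rep g, Pi.add_apply]),
          ev_derFun hV v (ev_eq_rep f), ev_derFun hV v (ev_eq_rep g), fderiv_add hf hg]
        rfl
      map_smul' := fun c f => by
        refine ext_ev fun t => ?_
        have hf := (analyticOnNhd_rep f t t.2).differentiableAt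
        rw [RingHom.id_apply, map_smul,
          ev_derFun hV v (F := c • rep f) (fun t => by simp [ev_eq_rep]),
          ev_derFun hV v (ev_eq_rep f), fderiv_const_smul hf]
        rfl }
    (fun f g => by
      refine ext_ev fun t => ?_
      have hf := (analyticOnNhd_rep f t t.2).differentiableAt
      have hg := (analyticOnNhd_rep g t t.2).differentiableAt
      simp only [LinearMap.coe_mk, AddHom.coe_mk, smul_eq_mul, map_add, map_mul]
      rw [ev_derFun hV v (F := rep f * rep g)
          (fun t => by rw [map_mul, ev_eq_rep f, ev_eq_rep g, Pi.mul_apply]),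
        ev_derFun hV v (ev_eq_rep f), ev_derFun hV v (ev_eq_rep g), fderiv_mul hf hg,
        ev_eq_rep, ev_eq_rep]
      rfl)

theorem ev_der (hV : IsOpen V) (v : Pt N) {f : Hol V} {F : Pt N → ℂ}
    (h : ∀ t : V, ev t f = F t) (t : V) : ev t (der hV v f) = fderiv ℂ F t v :=
  ev_derFun hV v h t

theorem fderiv_apply_eq_sum (F : Pt N → ℂ) (t v : Pt N) :
    fderiv ℂ F t v = ∑ α, v α * pd α F t := by
  conv_lhs => rw [pi_eq_sum_univ' v]
  rw [map_sum]
  refine Finset.sum_congr rfl fun α _ => ?_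
  rw [map_smul, smul_eq_mul]
  rfl

/-- The partial derivative `∂_α`. -/
noncomputable def partialDer (hV : IsOpen V) (α : Fin N) : Derivation ℂ (Hol V) (Hol V) :=
  der hV (Pi.single α 1)

theorem ev_partialDer (hV : IsOpen V) (α : Fin N) {f : Hol V} {F : Pt N → ℂ}
    (h : ∀ t : V, ev t f = F t) (t : V) : ev t (partialDer hV α f) = pd α F t :=
  ev_der hV _ h t

theorem der_comm (hV : IsOpen V) (v w : Pt N) (f : Hol V) :
    der hV v (der hV w f) = der hV w (der hV v f) := by
  refine ext_ev fun t => ?_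
  have hF := analyticOnNhd_rep f t t.2
  have hd : DifferentiableAt ℂ (fderiv ℂ (rep f)) t := hF.fderiv.differentiableAt
  have h1 : ∀ v w : Pt N, ev t (der hV v (der hV w f))
      = fderiv ℂ (fderiv ℂ (rep f)) t v w := by
    intro v w
    rw [ev_der hV v (F := fun t => fderiv ℂ (rep f) t w) (ev_der hV w (ev_eq_rep f)),
       fderiv_clm_apply hd (differentiableAt_const _)]
    simp
  rw [h1, h1]
  exact hF.contDiffAt.isSymmSndFDerivAt_of_omega v w

/-- Poincaré lemma for the closed form ∑ θ_α dt^α on a convex set. -/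
theorem exists_partialDer_eq (hV : IsOpen V) (hc : Convex ℝ V) (θ : Fin N → Hol V)
    (h : ∀ α β, partialDer hV α (θ β) = partialDer hV β (θ α)) :
    ∃ f : Hol V, ∀ α, partialDer hV α f = θ α := by
  obtain ⟨π, hπ⟩ : ∃ π : Fin N → Pt N →L[ℂ] ℂ, ∀ α v, π α v = v α :=
    ⟨fun α => ContinuousLinearMap.proj α, fun α v => rfl⟩
  set w : Pt N → Pt N →L[ℂ] ℂ := fun t =>
    ∑ α, rep (θ α) t • π α with hw
  have hwa : AnalyticOnNhd ℂ w V := by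
    intro t ht
    refine Finset.analyticAt_fun_sum _ fun α _ => ?_
    exact (analyticOnNhd_rep (θ α) t ht).smul analyticAt_const
  have hdw : ∀ t ∈ V, ∀ x y, fderiv ℂ w t x y = ∑ α, fderiv ℂ (rep (θ α)) t x * y α := by
    intro t ht x y
    have hd : ∀ α ∈ (Finset.univ : Finset (Fin N)), DifferentiableAt ℂ (fun t => rep (θ α) t •
        π α) t := fun α _ =>
      (analyticOnNhd_rep (θ α) t ht).differentiableAt.smul_const _
    rw [hw, fderiv_fun_sum hd]
    simp only [_root_.sum_apply]
    refine Finset.sum_congr rfl fun α _ => ?_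
    have h1 : HasFDerivAt (fun t => rep (θ α) t •
        π α)
        ((fderiv ℂ (rep (θ α)) t).smulRight (π α)) t :=
      (analyticOnNhd_rep (θ α) t ht).differentiableAt.hasFDerivAt.smul_const (π α)
    rw [h1.fderiv]
    simp [hπ]
  have hsymm : ∀ t ∈ V, ∀ x y, fderiv ℂ w t x y = fderiv ℂ w t y x := by
    intro t ht x y
    rw [hdw t ht, hdw t ht]
    simp only [fderiv_apply_eq_sum, Finset.sum_mul]
    rw [Finset.sum_comm]
    refine Finset.sum_congr rfl fun α _ => Finset.sum_congr rfl fun β _ => ?_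
    have := congrArg (ev ⟨t, ht⟩) (h α β)
    rw [ev_partialDer hV α (ev_eq_rep _), ev_partialDer hV β (ev_eq_rep _)] at this
    rw [this]
    ring
  -- Convexity is a real notion, so the symmetry is supplied for the real derivative of w; the
  -- primitive obtained is nevertheless complex differentiable.
  obtain ⟨f, hf⟩ := hc.exists_forall_hasFDerivAt_of_fderiv_symmetric hV (ω := w)
    (fun t ht => ((hwa t ht).differentiableAt.restrictScalars ℝ).differentiableWithinAt)
    (fun t ht x y => by
      rw [(hwa t ht).differentiableAt.fderiv_restrictScalars ℝ]
      exact hsymm t ht x y)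
  have hfa : AnalyticOnNhd ℂ f V := fun t ht =>
    AnalyticAt.of_hasFDerivAt (hwa t ht) (by
      filter_upwards [hV.mem_nhds ht] with x hx using hf x hx)
  refine ⟨mk f hfa, fun α => ext_ev fun t => ?_⟩
  rw [ev_partialDer hV α (ev_mk f hfa), pd, (hf t t.2).fderiv, ev_eq_rep]
  simp [hw, hπ, Pi.single_apply]

theorem exists_eq_algebraMap (hV : IsOpen V) (hc : Convex ℝ V) (f : Hol V)
    (h : ∀ α, partialDer hV α f = 0) : ∃ c : ℂ, f = algebraMap ℂ (Hol V) c := by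
  rcases V.eq_empty_or_nonempty with rfl | ⟨a, ha⟩
  · exact ⟨0, ext_ev fun t => t.2.elim⟩
  · refine ⟨rep f a, ext_ev fun t => ?_⟩
    rw [AlgHom.commutes, ev_eq_rep]
    refine hV.is_const_of_fderiv_eq_zero hc.isPreconnected (𝕜 := ℂ)
      (analyticOnNhd_rep f).differentiableOn ?_ t.2 ha
    intro x hx
    ext v
    rw [fderiv_apply_eq_sum]
    refine Finset.sum_eq_zero fun α _ => ?_
    rw [← ev_partialDer hV α (ev_eq_rep f) ⟨x, hx⟩, h, map_zero, mul_zero]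

instance [Nonempty V] : Nontrivial (Hol V) :=
  (ev (Classical.arbitrary V)).toRingHom.domain_nontrivial

end Hol

/-! ### The connection of a Frobenius structure in canonical coordinates -/

section Diagonalization

variable {A : Type*} [CommRing A] [Algebra ℂ A] {N : ℕ} {der : Fin N → Derivation ℂ A A}
  {C : Fin N → Matrix (Fin N) (Fin N) A} {P Q : Matrix (Fin N) (Fin N) A} {d : Fin N → Fin N → A}

/-- Differentiate C_α P = P diag(d_α) and multiply by Q = P⁻¹. The bracket has zero diagonal, so
eigenvalue and eigenvector derivatives separate. -/
theorem mul_map_mul_eq_of_diagonalized (hPQ : P * Q = 1) (hQP : Q * P = 1)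
    (hC : ∀ α, C α * P = P * Matrix.diagonal (d α)) (α β : Fin N) :
    Q * (C α).map (der β) * P
      = Q * P.map (der β) * Matrix.diagonal (d α) - Matrix.diagonal (d α) * (Q * P.map (der β))
        + Matrix.diagonal fun i => der β (d α i) := by
  have h1 := congrArg (fun Y : Matrix (Fin N) (Fin N) A => Q * Y.map (der β)) (hC α)
  simp only [Derivation.matrix_mul, mul_add, Derivation.matrix_diagonal] at h1
  have h2 : Q * (C α * P.map (der β)) = Matrix.diagonal (d α) * (Q * P.map (der β)) := by
    have : C α = P * Matrix.diagonal (d α) * Q := by rw [← hC, mul_assoc, hPQ, mul_one]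
    rw [this]
    simp only [← mul_assoc, hQP, one_mul]
  rw [h2, ← mul_assoc Q P, hQP, one_mul, ← mul_assoc, ← mul_assoc] at h1
  rw [eq_sub_of_add_eq h1]
  simp only [mul_assoc]
  abel

/-- The diagonal shows that the eigenvalue forms are closed, and the rest is the symmetry of [P⁻¹∂_α
P, d_β]. The first yields canonical coordinates from idempotents, the second the symmetry of the
connection form. -/
theorem der_eq_and_bracket_eq_of_diagonalized (hPQ : P * Q = 1) (hQP : Q * P = 1)
    (hC : ∀ α, C α * P = P * Matrix.diagonal (d α))
    (hsymm : ∀ α β, (C α).map (der β) = (C β).map (der α)) (α β : Fin N) :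
    (∀ i, der α (d β i) = der β (d α i)) ∧
      Q * P.map (der α) * Matrix.diagonal (d β) - Matrix.diagonal (d β) * (Q * P.map (der α))
        = Q * P.map (der β) * Matrix.diagonal (d α)
          - Matrix.diagonal (d α) * (Q * P.map (der β)) := by
  have h := mul_map_mul_eq_of_diagonalized (der := der) hPQ hQP hC α β
  rw [hsymm, mul_map_mul_eq_of_diagonalized hPQ hQP hC] at h
  have hd : ∀ i, der α (d β i) = der β (d α i) := by
    intro i
    have := congrFun (congrFun h i) i
    simp only [Matrix.add_apply, Matrix.sub_apply, Matrix.mul_diagonal, Matrix.diagonal_mul,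
      Matrix.diagonal_apply_eq] at this
    linear_combination this
  refine ⟨hd, ?_⟩
  simp only [hd] at h
  exact add_right_cancel h

end Diagonalization

/-- A Frobenius structure with canonical coordinates `u^i` and branches `s_i` of `Δ_i^{-1/2}`
over a ring of functions: `C_α` is diagonalized by the differentials of the coordinates, and so
is the metric after rescaling by `s`. -/
structure CanonicalFrame (A : Type*) [CommRing A] [Algebra ℂ A] (N : ℕ) where
  der : Fin N → Derivation ℂ A A
  der_comm : ∀ α β f, der α (der β f) = der β (der α f)
  exact : ∀ θ : Fin N → A, (∀ α β, der α (θ β) = der β (θ α)) → ∃ f, ∀ α, der α f = θ α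
  const : ∀ f, (∀ α, der α f = 0) → ∃ c : ℂ, f = algebraMap ℂ A c
  u : Fin N → A
  inv : Matrix (Fin N) (Fin N) A
  jac_mul_inv : (Matrix.of fun i β => der β (u i)) * inv = 1
  C : Fin N → Matrix (Fin N) (Fin N) A
  map_C : ∀ α β, (C α).map (der β) = (C β).map (der α)
  C_mul : ∀ α, C α * (Matrix.of fun β i => der β (u i))
    = (Matrix.of fun β i => der β (u i)) * Matrix.diagonal fun i => der α (u i)
  s : Fin N → A
  g : Matrix (Fin N) (Fin N) A
  g' : Matrix (Fin N) (Fin N) A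
  g_mul : g * g' = 1
  map_g : ∀ δ : Derivation ℂ A A, g.map δ = 0
  map_g' : ∀ δ : Derivation ℂ A A, g'.map δ = 0
  g_symm : gᵀ = g
  metric : (Matrix.of fun β i => s i * der β (u i)) * (Matrix.of fun β i => s i * der β (u i))ᵀ = g

namespace CanonicalFrame

variable {A : Type*} [CommRing A] [Algebra ℂ A] {N : ℕ} (c : CanonicalFrame A N)

/-- The matrix `∂_β u^i`. -/
def P : Matrix (Fin N) (Fin N) A := Matrix.of fun β i => c.der β (c.u i)

/-- The transition matrix. -/
def Ψ : Matrix (Fin N) (Fin N) A := Matrix.of fun β i => c.s i * c.der β (c.u i)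

/-- The inverse of the transition matrix. -/
def Ψ' : Matrix (Fin N) (Fin N) A := c.Ψᵀ * c.g'

/-- The matrix `∂_α U`. -/
def D (α : Fin N) : Matrix (Fin N) (Fin N) A := Matrix.diagonal fun i => c.der α (c.u i)

/-- The connection form `Ψ⁻¹ dΨ`. -/
def ω (α : Fin N) : Matrix (Fin N) (Fin N) A := c.Ψ' * c.Ψ.map (c.der α)

theorem Ψ_eq : c.Ψ = c.P * Matrix.diagonal c.s := by
  ext i j
  rw [Matrix.mul_diagonal, Ψ, P, Matrix.of_apply, Matrix.of_apply, mul_comm]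

theorem C_mul_Ψ (α : Fin N) : c.C α * c.Ψ = c.Ψ * c.D α := by
  have h : c.C α * c.P = c.P * c.D α := c.C_mul α
  rw [Ψ_eq, ← mul_assoc, h, mul_assoc, mul_assoc, D, Matrix.diagonal_mul_diagonal,
    Matrix.diagonal_mul_diagonal]
  simp only [mul_comm]

theorem Ψ_mul_Ψ' : c.Ψ * c.Ψ' = 1 := by
  have h : c.Ψ * c.Ψᵀ = c.g := c.metric
  rw [Ψ', ← mul_assoc, h, c.g_mul]

theorem Ψ'_mul_Ψ : c.Ψ' * c.Ψ = 1 := mul_eq_one_comm.mp c.Ψ_mul_Ψ'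

theorem Ψ_mul_ω (α : Fin N) : c.Ψ * c.ω α = c.Ψ.map (c.der α) := by
  rw [ω, ← mul_assoc, Ψ_mul_Ψ', one_mul]

/-- Differentiate Ψᵗ g⁻¹ Ψ = 1, with g constant. -/
theorem ω_transpose (α : Fin N) : (c.ω α)ᵀ = -c.ω α := by
  have h1 := congrArg (fun Y : Matrix (Fin N) (Fin N) A => Y.map (c.der α)) c.Ψ'_mul_Ψ
  have hg' : c.g'ᵀ = c.g' := by
    have h2 : c.g' * c.g = 1 := mul_eq_one_comm.mp c.g_mul
    have h3 : c.g * c.g'ᵀ = 1 := by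
      have := congrArg Matrix.transpose h2
      rwa [Matrix.transpose_mul, c.g_symm, Matrix.transpose_one] at this
    calc c.g'ᵀ = c.g' * c.g * c.g'ᵀ := by rw [h2, one_mul]
      _ = c.g' := by rw [mul_assoc, h3, mul_one]
  simp only [Derivation.matrix_mul, Derivation.matrix_one, Ψ', c.map_g', mul_zero, add_zero] at h1
  rw [ω, Ψ', eq_neg_iff_add_eq_zero, ← h1]
  simp only [Matrix.transpose_mul, Matrix.transpose_transpose, hg', mul_assoc, Matrix.transpose_map]

/-- Both sides equal Ψ⁻¹ ∂_α ∂_β Ψ. -/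
theorem ω_flat (α β : Fin N) :
    (c.ω β).map (c.der α) + c.ω α * c.ω β = (c.ω α).map (c.der β) + c.ω β * c.ω α := by
  have h : ∀ α β, (c.ω β).map (c.der α) + c.ω α * c.ω β
      = c.Ψ' * (c.Ψ.map (c.der β)).map (c.der α) := by
    intro α β
    have h1 := congrArg (fun Y : Matrix (Fin N) (Fin N) A => c.Ψ' * Y.map (c.der α)) (c.Ψ_mul_ω β)
    simp only [Derivation.matrix_mul, mul_add] at h1
    rw [← mul_assoc, ← mul_assoc, c.Ψ'_mul_Ψ, one_mul] at h1
    rw [← h1, add_comm]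
    rfl
  have h2 : (c.Ψ.map (c.der β)).map (c.der α) = (c.Ψ.map (c.der α)).map (c.der β) := by
    ext i j
    simp [c.der_comm α β]
  rw [h, h, h2]

theorem ω_bracket (α β : Fin N) :
    c.ω α * c.D β - c.D β * c.ω α = c.ω β * c.D α - c.D α * c.ω β :=
  (der_eq_and_bracket_eq_of_diagonalized c.Ψ_mul_Ψ' c.Ψ'_mul_Ψ c.C_mul_Ψ c.map_C α β).2

/-- The connection `Ψ⁻¹ dΨ` in canonical coordinates. -/
def toConnection : CoordinateConnection A N where
  der := c.der
  der_comm := c.der_comm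
  exact := c.exact
  const := c.const
  u := c.u
  inv := c.inv
  jac_mul_inv := c.jac_mul_inv
  ω := c.ω
  skew := c.ω_transpose
  flat := c.ω_flat
  symm := c.ω_bracket

/-- Gauge transformation by Ψ: it turns C_α into ∂_α U and d into d + ω. -/
theorem isSolution_iff {R : Matrix (Fin N) (Fin N) A⟦X⟧} :
    c.toConnection.IsSolution R ↔ ∀ α,
      (PowerSeries.X : A⟦X⟧) • (c.Ψ.map PowerSeries.C * R).map
          (PowerSeries.coeffDerivation (c.der α))
        + c.Ψ.map PowerSeries.C * R * (c.D α).map PowerSeries.C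
      = (c.C α).map PowerSeries.C * (c.Ψ.map PowerSeries.C * R) := by
  refine forall_congr' fun α => ?_
  have hC : ∀ Y Z : Matrix (Fin N) (Fin N) A, (Y * Z).map (PowerSeries.C : A →+* A⟦X⟧)
      = Y.map PowerSeries.C * Z.map PowerSeries.C := fun Y Z => Matrix.map_mul
  have h1 : (c.Ψ.map (PowerSeries.C : A →+* A⟦X⟧)).map (PowerSeries.coeffDerivation (c.der α))
      = c.Ψ.map PowerSeries.C * (c.ω α).map PowerSeries.C := by
    rw [← hC, Ψ_mul_ω]
    ext1 i j
    simp
  have h2 : c.Ψ'.map (PowerSeries.C : A →+* A⟦X⟧) * c.Ψ.map PowerSeries.C = 1 := by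
    rw [← hC, Ψ'_mul_Ψ]
    exact Matrix.map_one _ (map_zero _) (map_one _)
  have h4 : (c.C α).map (PowerSeries.C : A →+* A⟦X⟧) * c.Ψ.map PowerSeries.C
      = c.Ψ.map PowerSeries.C * (c.D α).map PowerSeries.C := by
    rw [← hC, C_mul_Ψ, hC]
  rw [Derivation.matrix_mul, h1, ← mul_assoc ((c.C α).map _), h4]
  set p := c.Ψ.map (PowerSeries.C : A →+* A⟦X⟧)
  change _ • _ = (c.D α).map PowerSeries.C * R - R * (c.D α).map PowerSeries.C
    - (PowerSeries.X : A⟦X⟧) • ((c.ω α).map PowerSeries.C * R) ↔ _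
  constructor
  · intro h
    have h3 := congrArg (p * ·) h
    simp only [mul_sub, mul_smul_comm] at h3
    simp only [smul_add, mul_assoc]
    rw [show c.der α = c.toConnection.der α from rfl, h3]
    abel
  · intro h
    have h3 := congrArg (c.Ψ'.map (PowerSeries.C : A →+* A⟦X⟧) * ·) h
    simp only [mul_add, smul_add, mul_smul_comm, ← mul_assoc, h2, one_mul] at h3
    rw [show c.toConnection.der α = c.der α from rfl, eq_sub_iff_add_eq, eq_sub_iff_add_eq, ← h3]
    abel

end CanonicalFrame

/-! ### Euler fields -/

namespace CanonicalFrame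

variable {A : Type*} [CommRing A] [Algebra ℂ A] {N : ℕ} (c : CanonicalFrame A N)

/-- The derivation `∑ E^β ∂_β`. -/
def fieldDer (E : Fin N → A) : Derivation ℂ A A := ∑ β, E β • c.der β

/-- The matrix `∂_α E^β`. -/
def fieldJac (E : Fin N → A) : Matrix (Fin N) (Fin N) A := Matrix.of fun α β => c.der α (E β)

/-- The equations of an Euler field in flat coordinates. -/
structure IsEuler (E : Fin N → A) (d : ℂ) : Prop where
  metric : c.fieldJac E * c.g + c.g * (c.fieldJac E)ᵀ = (2 - d) • c.g
  mul : ∀ α, (c.C α).map (c.fieldDer E)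
    = c.C α + c.C α * c.fieldJac E - c.fieldJac E * c.C α - ∑ β, c.fieldJac E α β • c.C β

variable {c} {E : Fin N → A} {d : ℂ}

theorem fieldDer_apply (f : A) : c.fieldDer E f = ∑ β, E β * c.der β f := by
  have h : ∀ s : Finset (Fin N), (∑ β ∈ s, E β • c.der β) f = ∑ β ∈ s, E β * c.der β f := by
    intro s
    induction s using Finset.induction_on with
    | empty => simp
    | insert a s ha ih =>
      rw [Finset.sum_insert ha, Finset.sum_insert ha, Derivation.add_apply, ih,
        Derivation.smul_apply, smul_eq_mul]
  exact h _

theorem fieldDer_der (α : Fin N) (f : A) :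
    c.fieldDer E (c.der α f)
      = c.der α (c.fieldDer E f) - ∑ β, c.fieldJac E α β * c.der β f := by
  rw [fieldDer_apply, fieldDer_apply, map_sum, ← Finset.sum_sub_distrib]
  refine Finset.sum_congr rfl fun β _ => ?_
  rw [Derivation.leibniz, fieldJac, Matrix.of_apply, c.der_comm α β, smul_eq_mul, smul_eq_mul]
  ring

theorem eq_zero_of_two_mul_eq_zero {x : A} (h : 2 * x = 0) : x = 0 := by
  have := congrArg (fun x => (2⁻¹ : ℂ) • x) h
  have h2 : (2 : A) * x = (2 : ℂ) • x := by
    rw [two_smul]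
    ring
  simpa [h2, smul_smul] using this

theorem inv_mul_P : c.invᵀ * c.P = 1 ∧ c.P * c.invᵀ = 1 := by
  have h := congrArg Matrix.transpose c.jac_mul_inv
  rw [Matrix.transpose_mul, Matrix.transpose_one] at h
  exact ⟨h, mul_eq_one_comm.mp h⟩

/-- `L_E du^i = du^i`. -/
theorem IsEuler.fieldDer_der_u (h : c.IsEuler E d) (α i : Fin N) :
    c.fieldDer E (c.der α (c.u i))
      = c.der α (c.u i) - ∑ β, c.fieldJac E α β * c.der β (c.u i) := by
  set M := c.fieldJac E with hM
  -- W is the defect L_E du - du. Applying E to C_α P = P ∂_α U and inserting the Euler equation for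
  -- C_α leaves P diag(W_α) = C_α W - W ∂_α U. Conjugated by P, the right side is a bracket with a
  -- diagonal matrix, whose diagonal is zero, so W vanishes row by row.
  set W : Matrix (Fin N) (Fin N) A := c.P.map (c.fieldDer E) + M * c.P - c.P with hW
  have hWα : ∀ α, (c.D α).map (c.fieldDer E) + ∑ β, M α β • c.D β - c.D α
      = Matrix.diagonal (W α) := by
    intro α
    ext i j
    simp only [Matrix.sub_apply, Matrix.add_apply, Matrix.map_apply, Matrix.sum_apply,
      Matrix.smul_apply, D, Matrix.diagonal_apply, hW, Matrix.mul_apply, P, Matrix.of_apply,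
      smul_eq_mul]
    split_ifs <;> simp
  have hCP : ∀ α, c.C α * c.P = c.P * c.D α := c.C_mul
  have key : ∀ α, c.P * Matrix.diagonal (W α) = c.C α * W - W * c.D α := by
    intro α
    have h1 := congrArg (fun Y : Matrix (Fin N) (Fin N) A => Y.map (c.fieldDer E)) (hCP α)
    simp only [Derivation.matrix_mul] at h1
    have h2 : c.P.map (c.fieldDer E) = c.P - M * c.P + W := by rw [hW]; abel
    have h3 : (c.D α).map (c.fieldDer E)
        = c.D α - ∑ β, M α β • c.D β + Matrix.diagonal (W α) := by rw [← hWα]; abel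
    have h4 : (∑ β, M α β • c.C β) * c.P = c.P * ∑ β, M α β • c.D β := by
      rw [Finset.sum_mul, Finset.mul_sum]
      refine Finset.sum_congr rfl fun β _ => ?_
      rw [smul_mul_assoc, mul_smul_comm, hCP]
    rw [h.mul, h2, h3, ← hM] at h1
    simp only [add_mul, sub_mul, mul_add, mul_sub, mul_assoc, h4, hCP] at h1
    rw [← sub_eq_zero] at h1 ⊢
    rw [← neg_eq_zero, ← h1]
    abel
  have hW0 : Matrix.diagonal (W α) = 0 := by
    have h1 := congrArg (c.invᵀ * ·) (key α)
    have h2 : c.C α = c.P * c.D α * c.invᵀ := by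
      rw [← hCP, mul_assoc, inv_mul_P.2, mul_one]
    simp only [mul_sub, ← mul_assoc, h2, inv_mul_P.1, one_mul] at h1
    rw [mul_assoc (c.D α)] at h1
    ext i j
    rw [Matrix.diagonal_apply]
    split_ifs with hij
    · have h3 := congrFun (congrFun h1 i) i
      rw [Matrix.diagonal_apply_eq, Matrix.sub_apply, D, Matrix.diagonal_mul,
        Matrix.mul_diagonal] at h3
      rw [h3, Matrix.zero_apply]
      ring
    · rfl
  have h5 := congrFun (congrFun hW0 i) i
  simp only [Matrix.diagonal_apply_eq, hW, Matrix.sub_apply, Matrix.add_apply, Matrix.map_apply,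
    P, Matrix.of_apply, Matrix.mul_apply, Matrix.zero_apply] at h5
  linear_combination h5

/-- An Euler field is affine in flat coordinates. -/
theorem IsEuler.map_fieldJac (h : c.IsEuler E d) (γ : Fin N) :
    (c.fieldJac E).map (c.der γ) = 0 := by
  set M := c.fieldJac E with hM
  -- T_γαβ = ∂_γ ∂_α E_β with the index lowered by g. It is symmetric in γ, α and, by the metric
  -- equation, skew in α, β; such a tensor is zero.
  set T : Fin N → Fin N → Fin N → A := fun γ α β => c.der γ ((M * c.g) α β) with hT
  have hg : ∀ α β γ, c.der γ (c.g α β) = 0 := fun α β γ =>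
    congrFun (congrFun (c.map_g (c.der γ)) α) β
  have h1 : ∀ γ α β, T γ α β = T α γ β := by
    intro γ α β
    simp only [hT, Matrix.mul_apply, map_sum, Derivation.leibniz, hg, mul_zero, zero_add,
      smul_eq_mul, hM, fieldJac, Matrix.of_apply, c.der_comm γ α]
  have h2 : ∀ γ α β, T γ α β = -T γ β α := by
    intro γ α β
    have h3 := congrArg (c.der γ) (congrFun (congrFun h.metric α) β)
    have h4 : c.g * Mᵀ = (M * c.g)ᵀ := by rw [Matrix.transpose_mul, c.g_symm]
    rw [h4, Matrix.add_apply, Matrix.transpose_apply, Matrix.smul_apply, map_add, Derivation.map_smul, hg,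
      smul_zero] at h3
    exact eq_neg_of_add_eq_zero_left h3
  have h3 : ∀ γ α β, T γ α β = 0 := by
    intro γ α β
    refine eq_zero_of_two_mul_eq_zero ?_
    have : T γ α β = -T γ α β :=
      calc T γ α β = T α γ β := h1 ..
        _ = -T α β γ := h2 ..
        _ = -T β α γ := by rw [h1 α]
        _ = T β γ α := by rw [h2 β, neg_neg]
        _ = T γ β α := h1 ..
        _ = -T γ α β := h2 ..
    linear_combination this
  have h5 : (M * c.g).map (c.der γ) = 0 := by
    ext α β
    exact h3 γ α β
  rw [Derivation.matrix_mul, c.map_g, mul_zero, add_zero] at h5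
  rw [← mul_one (M.map _), ← c.g_mul, ← mul_assoc, h5, zero_mul]

theorem IsEuler.map_P (h : c.IsEuler E d) :
    c.P.map (c.fieldDer E) = c.P - c.fieldJac E * c.P := by
  ext α i
  simp only [Matrix.map_apply, Matrix.sub_apply, Matrix.mul_apply, P, Matrix.of_apply]
  exact h.fieldDer_der_u α i

/-- In g = ∑ s_i² (du^i)² the metric has weight 2 - d and each du^i weight 1, so s_i² has weight -d.
-/
theorem IsEuler.map_s (h : c.IsEuler E d) :
    (Matrix.diagonal c.s).map (c.fieldDer E) = (-(d / 2)) • Matrix.diagonal c.s := by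
  set M := c.fieldJac E with hM
  set S : Matrix (Fin N) (Fin N) A := Matrix.diagonal c.s with hS
  set S' := S.map (c.fieldDer E) with hS'
  have hg : c.P * S * (c.P * S)ᵀ = c.g := by
    have : c.Ψ * c.Ψᵀ = c.g := c.metric
    rwa [Ψ_eq] at this
  have hSt : Sᵀ = S := Matrix.diagonal_transpose _
  have hSt' : S'ᵀ = S' := by
    rw [hS', ← Matrix.transpose_map, hSt]
  have h1 := congrArg (fun Y : Matrix (Fin N) (Fin N) A => Y.map (c.fieldDer E)) hg
  have h2 : (c.P * S).map (c.fieldDer E) = c.P * S - M * (c.P * S) + c.P * S' := by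
    rw [Derivation.matrix_mul, h.map_P, sub_mul, mul_assoc M]
  simp only [Derivation.matrix_mul (Y := (c.P * S)ᵀ), Matrix.transpose_map, h2, c.map_g] at h1
  have h3 : (2 : ℂ) • c.g - (2 - d) • c.g + (2 : ℂ) • (c.P * (S * S') * c.Pᵀ) = 0 := by
    rw [← h.metric, ← h1, ← hM]
    have hcomm : S' * S = S * S' := by
      rw [hS', hS, Derivation.matrix_diagonal, Matrix.diagonal_mul_diagonal,
        Matrix.diagonal_mul_diagonal]
      simp only [mul_comm]
    have h4 : c.P * S' * (c.P * S)ᵀ = c.P * (S * S') * c.Pᵀ := by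
      rw [Matrix.transpose_mul, hSt, ← hcomm]
      simp only [mul_assoc]
    have h5 : c.P * S * (c.P * S')ᵀ = c.P * (S * S') * c.Pᵀ := by
      rw [Matrix.transpose_mul, hSt']
      simp only [mul_assoc]
    have h6 : M * (c.P * S) * (c.P * S)ᵀ = M * c.g := by rw [mul_assoc, hg]
    have h7 : c.P * S * (M * (c.P * S))ᵀ = c.g * Mᵀ := by
      rw [Matrix.transpose_mul M, ← mul_assoc, hg]
    simp only [Matrix.transpose_add, Matrix.transpose_sub, add_mul, sub_mul, mul_add, mul_sub, h4,
      h5, h6, h7, hg, two_smul]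
    abel
  have h4 : c.P * (S * (d • S + (2 : ℂ) • S')) * c.Pᵀ = 0 := by
    rw [← h3, ← sub_smul, sub_sub_cancel, ← hg, Matrix.transpose_mul, hSt]
    simp only [mul_add, add_mul, mul_smul_comm, smul_mul_assoc, mul_assoc]
  have hPt : c.Pᵀ * c.inv = 1 := by
    have := congrArg Matrix.transpose (inv_mul_P (c := c)).1
    rwa [Matrix.transpose_mul, Matrix.transpose_transpose, Matrix.transpose_one] at this
  have h5 : d • S + (2 : ℂ) • S' = 0 := by
    have hl : c.Ψ' * c.P * S = 1 := by rw [mul_assoc, ← Ψ_eq, Ψ'_mul_Ψ]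
    calc d • S + (2 : ℂ) • S' = (c.Ψ' * c.P * S) * (d • S + (2 : ℂ) • S') * (c.Pᵀ * c.inv) := by
          rw [hl, hPt, one_mul, mul_one]
      _ = c.Ψ' * (c.P * (S * (d • S + (2 : ℂ) • S')) * c.Pᵀ) * c.inv := by
          simp only [mul_assoc]
      _ = 0 := by rw [h4, mul_zero, zero_mul]
  have h6 : (2 : ℂ) • S' = -(d • S) := eq_neg_of_add_eq_zero_right h5
  calc S' = (2⁻¹ : ℂ) • (2 : ℂ) • S' := by rw [smul_smul]; norm_num
    _ = _ := by rw [h6, smul_neg, smul_smul, neg_smul]; congr 2; ring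

theorem IsEuler.map_Ψ (h : c.IsEuler E d) :
    c.Ψ.map (c.fieldDer E) = (1 - d / 2) • c.Ψ - c.fieldJac E * c.Ψ := by
  rw [Ψ_eq, Derivation.matrix_mul, h.map_P, h.map_s, sub_mul, mul_smul_comm, neg_smul, sub_smul,
    one_smul, mul_assoc]
  abel

/-- L_E ω = 0 because E acts on Ψ by a scalar and by left multiplication with the matrix ∂E, which
is constant by `IsEuler.map_fieldJac`; both cancel in Ψ⁻¹dΨ. -/
theorem IsEuler.isHomogeneousDerivation (h : c.IsEuler E d) :
    c.toConnection.IsHomogeneousDerivation (c.fieldDer E) (c.fieldJac E) where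
  der_comm := fieldDer_der
  der_u := h.fieldDer_der_u
  map_ω α := by
    set M := c.fieldJac E with hM
    change (c.ω α).map (c.fieldDer E) = -∑ β, M α β • c.ω β
    have h1 : (c.Ψ.map (c.der α)).map (c.fieldDer E)
        = (c.Ψ.map (c.fieldDer E)).map (c.der α) - ∑ β, M α β • c.Ψ.map (c.der β) := by
      ext i j
      simp only [Matrix.map_apply, Matrix.sub_apply, Matrix.sum_apply, Matrix.smul_apply,
        smul_eq_mul, fieldDer_der, hM]
    have h2 : (c.Ψ.map (c.fieldDer E)).map (c.der α)
        = (1 - d / 2) • c.Ψ.map (c.der α) - M * c.Ψ.map (c.der α) := by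
      have h3 : ((1 - d / 2) • c.Ψ).map (c.der α) = (1 - d / 2) • c.Ψ.map (c.der α) := by
        ext i j
        simp
      rw [h.map_Ψ, Derivation.matrix_sub, Derivation.matrix_mul, h.map_fieldJac, zero_mul,
        zero_add, h3]
    have h3 : (c.Ψ * c.ω α).map (c.fieldDer E) = (c.Ψ.map (c.der α)).map (c.fieldDer E) := by
      rw [Ψ_mul_ω]
    rw [Derivation.matrix_mul, h1, h2, h.map_Ψ] at h3
    simp only [sub_mul, smul_mul_assoc, mul_assoc, Ψ_mul_ω] at h3
    have h4 : c.Ψ * (c.ω α).map (c.fieldDer E) = c.Ψ * -∑ β, M α β • c.ω β := by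
      rw [mul_neg, Finset.mul_sum]
      simp only [mul_smul_comm, Ψ_mul_ω]
      rw [← sub_eq_zero] at h3 ⊢
      rw [← h3]
      abel
    have h5 := congrArg (c.Ψ' * ·) h4
    simp only [← mul_assoc, Ψ'_mul_Ψ, one_mul] at h5
    exact h5

end CanonicalFrame

/-! ### Pointwise algebra in a frame of idempotents -/

namespace FrobeniusStructure

variable {N : ℕ} (Fr : FrobeniusStructure N) {t : Pt N} {J K : Matrix (Fin N) (Fin N) ℂ}

theorem mul_apply (a b : Pt N) (ν : Fin N) :
    Fr.mul t a b ν = ∑ α, a α * ∑ β, b β * Fr.connMatrix α t β ν := by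
  simp only [mul, frobMul, connMatrix, Matrix.of_apply, Finset.mul_sum]
  refine Finset.sum_congr rfl fun α _ => Finset.sum_congr rfl fun β _ =>
    Finset.sum_congr rfl fun μ _ => ?_
  ring

/-- The columns of K are idempotents and φ_α = ∑ J_iα ∂_i, so multiplication by φ_α has eigenvalue
J_iα on ∂_i. -/
theorem connMatrix_eq (hJK : J * K = 1)
    (h : ∀ i j, Fr.mul t (fun β => K β i) (fun β => K β j) = if i = j then fun β => K β i else 0)
    (α : Fin N) : Fr.connMatrix α t = Jᵀ * Matrix.diagonal (fun i => J i α) * Kᵀ := by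
  have hKJ : K * J = 1 := mul_eq_one_comm.mp hJK
  have hKJt : Jᵀ * Kᵀ = 1 := by rw [← Matrix.transpose_mul, hKJ, Matrix.transpose_one]
  have h1 : Kᵀ * Fr.connMatrix α t = Matrix.diagonal (fun i => J i α) * Kᵀ := by
    ext k ν
    have h2 : ∀ j, ∑ γ, J j α * (K γ j * ∑ β, K β k * Fr.connMatrix γ t β ν)
        = if j = k then J k α * K ν k else 0 := by
      intro j
      rw [← Finset.mul_sum, ← Fr.mul_apply (fun β => K β j) (fun β => K β k), h]
      split_ifs with hjk
      · rw [hjk]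
      · simp
    have h3 : ∀ γ, ∑ j, J j α * K γ j = if γ = α then 1 else 0 := by
      intro γ
      have := congrFun (congrFun hKJ γ) α
      rw [Matrix.mul_apply, Matrix.one_apply] at this
      simpa only [mul_comm] using this
    have h4 := Finset.sum_congr (rfl : (Finset.univ : Finset (Fin N)) = _) fun j _ => h2 j
    rw [Finset.sum_comm] at h4
    simp only [← mul_assoc, ← Finset.sum_mul, h3] at h4
    simp only [ite_mul, one_mul, zero_mul, Finset.sum_ite_eq', Finset.mem_univ, if_true] at h4
    rw [Matrix.diagonal_mul, Matrix.mul_apply]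
    exact h4
  rw [mul_assoc, ← h1, ← mul_assoc, hKJt, one_mul]

theorem connMatrix_mul (hJK : J * K = 1)
    (h : ∀ i j, Fr.mul t (fun β => K β i) (fun β => K β j) = if i = j then fun β => K β i else 0)
    (α : Fin N) : Fr.connMatrix α t * Jᵀ = Jᵀ * Matrix.diagonal (fun i => J i α) := by
  rw [Fr.connMatrix_eq hJK h, mul_assoc, ← Matrix.transpose_mul, hJK, Matrix.transpose_one,
    mul_one]

theorem pairing_eq (g : Matrix (Fin N) (Fin N) ℂ) (i j : Fin N) :
    pairing g (fun β => K β i) (fun β => K β j) = (Kᵀ * g * K) i j := by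
  simp only [pairing, Matrix.mul_apply, Matrix.transpose_apply, Finset.sum_mul]
  rw [Finset.sum_comm]
  refine Finset.sum_congr rfl fun α _ => Finset.sum_congr rfl fun β _ => ?_
  ring

/-- Distinct idempotents are orthogonal: (∂_i, ∂_j) = (∂_i • ∂_i, ∂_j) = (∂_i, ∂_i • ∂_j) = 0. -/
theorem g_eq (ht : t ∈ Fr.dom) (hJK : J * K = 1)
    (h : ∀ i j, Fr.mul t (fun β => K β i) (fun β => K β j) = if i = j then fun β => K β i else 0) :
    Fr.g = Jᵀ * Matrix.diagonal
      (fun i => pairing Fr.g (fun β => K β i) (fun β => K β i)) * J := by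
  have hKJ : K * J = 1 := mul_eq_one_comm.mp hJK
  have h1 : Kᵀ * Fr.g * K = Matrix.diagonal
      (fun i => pairing Fr.g (fun β => K β i) (fun β => K β i)) := by
    ext i j
    rw [← pairing_eq, Matrix.diagonal_apply]
    split_ifs with hij
    · rw [hij]
    · have h2 := Fr.mul_invariant t ht (fun β => K β i) (fun β => K β i) (fun β => K β j)
      have h3 : frobMul Fr.g Fr.F t (fun β => K β i) (fun β => K β i) = fun β => K β i :=
        (h i i).trans (if_pos rfl)
      have h4 : frobMul Fr.g Fr.F t (fun β => K β i) (fun β => K β j) = 0 :=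
        (h i j).trans (if_neg hij)
      rw [h3, h4] at h2
      rw [h2]
      simp [pairing]
  have hKJt : Jᵀ * Kᵀ = 1 := by rw [← Matrix.transpose_mul, hKJ, Matrix.transpose_one]
  rw [← h1]
  simp only [mul_assoc, hKJ, mul_one]
  rw [← mul_assoc, hKJt, one_mul]

theorem pairing_ne_zero (ht : t ∈ Fr.dom) (hJK : J * K = 1)
    (h : ∀ i j, Fr.mul t (fun β => K β i) (fun β => K β j) = if i = j then fun β => K β i else 0)
    (i : Fin N) : pairing Fr.g (fun β => K β i) (fun β => K β i) ≠ 0 := by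
  have h1 := congrArg Matrix.det (Fr.g_eq ht hJK h)
  rw [Matrix.det_mul, Matrix.det_mul, Matrix.det_diagonal] at h1
  intro h0
  rw [Finset.prod_eq_zero (Finset.mem_univ i) h0, mul_zero, zero_mul] at h1
  exact Fr.g_nondeg.ne_zero h1

end FrobeniusStructure

/-! ### The connection matrices over the holomorphic functions -/

namespace Hol

variable {N : ℕ} {V : Set (Pt N)}

theorem matrix_ext {X Y : Matrix (Fin N) (Fin N) (Hol V)}
    (h : ∀ t : V, X.map (ev t) = Y.map (ev t)) : X = Y := by
  ext1 i j
  exact ext_ev fun t => congrFun (congrFun (h t) i) j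

theorem matrix_map_mul (t : V) (X Y : Matrix (Fin N) (Fin N) (Hol V)) :
    (X * Y).map (ev t) = X.map (ev t) * Y.map (ev t) := Matrix.map_mul

/-- The matrix `C_α` with holomorphic entries. -/
noncomputable def conn (Fr : FrobeniusStructure N) (hV : IsOpen V) (hVd : V ⊆ Fr.dom)
    (α : Fin N) : Matrix (Fin N) (Fin N) (Hol V) :=
  Matrix.of fun β ν => ∑ μ, partialDer hV α (partialDer hV β (partialDer hV μ
    (mk Fr.F (Fr.analytic_F.mono hVd)))) * algebraMap ℂ (Hol V) (Fr.g⁻¹ μ ν)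

theorem conn_map_ev (Fr : FrobeniusStructure N) (hV : IsOpen V) (hVd : V ⊆ Fr.dom)
    (α : Fin N) (t : V) : (conn Fr hV hVd α).map (ev t) = Fr.connMatrix α t := by
  ext β ν
  rw [Matrix.map_apply, conn, Matrix.of_apply, map_sum, FrobeniusStructure.connMatrix,
    Matrix.of_apply]
  refine Finset.sum_congr rfl fun μ _ => ?_
  rw [map_mul, AlgHom.commutes]
  congr 1
  exact ev_partialDer hV α (F := pd β (pd μ Fr.F))
    (ev_partialDer hV β (F := pd μ Fr.F) (ev_partialDer hV μ (ev_mk _ _))) t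

theorem conn_map_der (Fr : FrobeniusStructure N) (hV : IsOpen V) (hVd : V ⊆ Fr.dom)
    (α β : Fin N) :
    (conn Fr hV hVd α).map (partialDer hV β) = (conn Fr hV hVd β).map (partialDer hV α) := by
  ext1 γ ν
  simp only [Matrix.map_apply, conn, Matrix.of_apply, map_sum, Derivation.leibniz,
    Derivation.map_algebraMap, smul_zero, zero_add]
  refine Finset.sum_congr rfl fun μ _ => ?_
  rw [partialDer, partialDer, der_comm]

end Hol

/-! ### Canonical coordinates as a frame over the holomorphic functions -/

section Frame

variable {N : ℕ} {Fr : FrobeniusStructure N} {V : Set (Pt N)} {u s : Fin N → Pt N → ℂ}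

theorem IsCanonicalCoordinates.jacobian_mul_inv (hu : IsCanonicalCoordinates Fr V u) {t : Pt N}
    (ht : t ∈ V) : jacobian u t * (jacobian u t)⁻¹ = 1 :=
  Matrix.mul_nonsing_inv _ (hu.jacobian_unit t ht)

theorem transition_eq (u s : Fin N → Pt N → ℂ) (t : Pt N) :
    transition u s t = (jacobian u t)ᵀ * Matrix.diagonal fun i => s i t := by
  ext β i
  rw [Matrix.mul_diagonal, Matrix.transpose_apply, transition, jacobian, Matrix.of_apply,
    Matrix.of_apply, mul_comm]

/-- Since s_i² = (∂_i, ∂_i), this is the diagonal form of the metric in the frame ∂_i. -/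
theorem IsCanonicalCoordinates.transition_mul_transpose (hu : IsCanonicalCoordinates Fr V u)
    (hs : IsInvSqrtHessian Fr V u s) {t : Pt N} (ht : t ∈ V) :
    transition u s t * (transition u s t)ᵀ = Fr.g := by
  rw [Fr.g_eq (hu.subset_dom ht) (hu.jacobian_mul_inv ht) (hu.idempotent t ht), transition_eq,
    Matrix.transpose_mul, Matrix.diagonal_transpose, Matrix.transpose_transpose, ← mul_assoc,
    mul_assoc _ (Matrix.diagonal _) (Matrix.diagonal _), Matrix.diagonal_mul_diagonal]
  congr 3
  funext i
  rw [← pow_two, (hs i).2 t ht, hessian, one_div, inv_inv]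
  rfl

/-- Canonical coordinates on a convex open set, as a frame over the holomorphic functions. -/
noncomputable def IsCanonicalCoordinates.frame (hV : IsOpen V) (hc : Convex ℝ V)
    (hu : IsCanonicalCoordinates Fr V u) (hs : IsInvSqrtHessian Fr V u s) :
    CanonicalFrame (Hol V) N where
  der := Hol.partialDer hV
  der_comm α β f := Hol.der_comm hV _ _ f
  exact := Hol.exists_partialDer_eq hV hc
  const := Hol.exists_eq_algebraMap hV hc
  u i := Hol.mk (u i) (hu.analytic i)
  inv := (Matrix.of fun i β => Hol.partialDer hV β (Hol.mk (u i) (hu.analytic i)))⁻¹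
  jac_mul_inv := by
    refine Matrix.mul_nonsing_inv _ (Hol.isUnit_of_ev_ne_zero fun t => ?_)
    rw [AlgHom.map_det]
    convert (hu.jacobian_unit t t.2).ne_zero using 2
    ext i β
    exact Hol.ev_partialDer hV β (Hol.ev_mk _ _) t
  C := Hol.conn Fr hV hu.subset_dom
  map_C := Hol.conn_map_der Fr hV hu.subset_dom
  C_mul α := by
    refine Hol.matrix_ext fun t => ?_
    rw [Hol.matrix_map_mul, Hol.matrix_map_mul, Hol.conn_map_ev,
      Matrix.diagonal_map (map_zero _)]
    have h := Fr.connMatrix_mul (hu.jacobian_mul_inv t.2) (hu.idempotent t t.2) α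
    convert h using 2
    · ext β i
      exact Hol.ev_partialDer hV β (Hol.ev_mk _ _) t
    · ext β i
      exact Hol.ev_partialDer hV β (Hol.ev_mk _ _) t
    · congr 1
      funext i
      exact Hol.ev_partialDer hV α (Hol.ev_mk _ _) t
  s i := Hol.mk (s i) (hs i).1
  g := Fr.g.map (algebraMap ℂ (Hol V))
  g' := Fr.g⁻¹.map (algebraMap ℂ (Hol V))
  g_mul := by
    rw [← Matrix.map_mul, Matrix.mul_nonsing_inv _ Fr.g_nondeg]
    exact Matrix.map_one _ (map_zero _) (map_one _)
  map_g δ := by ext1 i j; simp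
  map_g' δ := by ext1 i j; simp
  g_symm := by rw [← Matrix.transpose_map, Fr.g_symm]
  metric := by
    refine Hol.matrix_ext fun t => ?_
    rw [Hol.matrix_map_mul, Matrix.transpose_map]
    have h := hu.transition_mul_transpose hs t.2
    have h1 : (Matrix.of fun β i => Hol.mk (s i) (hs i).1
        * Hol.partialDer hV β (Hol.mk (u i) (hu.analytic i))).map (Hol.ev t)
        = transition u s t := by
      ext β i
      rw [Matrix.map_apply, Matrix.of_apply, map_mul,
        Hol.ev_partialDer hV β (Hol.ev_mk _ _), Hol.ev_mk]
      rfl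
    rw [h1, h]
    ext i j
    simp

end Frame

/-! ### Matrix series with holomorphic coefficients -/

namespace Hol

variable {N : ℕ} {V : Set (Pt N)}

/-- Evaluation of the coefficients of a power series. -/
noncomputable def evS (t : V) : (Hol V)⟦X⟧ →+* ℂ⟦X⟧ := PowerSeries.map (ev t : Hol V →+* ℂ)

theorem coeff_evS (t : V) (k : ℕ) (f : (Hol V)⟦X⟧) :
    PowerSeries.coeff k (evS t f) = ev t (PowerSeries.coeff k f) :=
  PowerSeries.coeff_map _ _ _

theorem series_ext {X Y : Matrix (Fin N) (Fin N) (Hol V)⟦X⟧}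
    (h : ∀ t : V, X.map (evS t) = Y.map (evS t)) : X = Y := by
  ext1 i j
  refine PowerSeries.ext fun k => ext_ev fun t => ?_
  rw [← coeff_evS, ← coeff_evS]
  exact congrArg _ (congrFun (congrFun (h t) i) j)

theorem evS_map_mul (t : V) (X Y : Matrix (Fin N) (Fin N) (Hol V)⟦X⟧) :
    (X * Y).map (evS t) = X.map (evS t) * Y.map (evS t) := Matrix.map_mul

theorem evS_map_C (t : V) (X : Matrix (Fin N) (Fin N) (Hol V)) :
    (X.map PowerSeries.C).map (evS t) = constSeries (X.map (ev t)) := by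
  ext1 i j
  exact PowerSeries.map_C (ev t : Hol V →+* ℂ) (X i j)

theorem evS_map_reflect (t : V) (X : Matrix (Fin N) (Fin N) (Hol V)⟦X⟧) :
    (PowerSeries.reflect X).map (evS t) = ((X.map (evS t)).map PowerSeries.evalNegHom)ᵀ := by
  ext1 i j
  exact (PowerSeries.evalNegHom_map (ev t : Hol V →+* ℂ) (X j i)).symm

theorem evS_map_constDiag (t : V) (q : Fin N → ℂ⟦X⟧) :
    (PowerSeries.constDiag (Hol V) q).map (evS t) = Matrix.diagonal q := by
  rw [PowerSeries.constDiag, Matrix.diagonal_map (map_zero _)]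
  congr 1

/-- `R` is given on `V` by the matrix `S` of series with holomorphic coefficients. -/
def Represents (S : Matrix (Fin N) (Fin N) (Hol V)⟦X⟧) (R : MatrixSeries N) : Prop :=
  ∀ t : V, R t = S.map (evS t)

variable {S : Matrix (Fin N) (Fin N) (Hol V)⟦X⟧} {R : MatrixSeries N}

theorem exists_represents (S : Matrix (Fin N) (Fin N) (Hol V)⟦X⟧) :
    ∃ R : MatrixSeries N, Represents S R := by
  classical
  exact ⟨fun t => if h : t ∈ V then S.map (evS ⟨t, h⟩) else 0, fun t => dif_pos t.2⟩

theorem exists_represented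
    (h : ∀ k i j, AnalyticOnNhd ℂ (fun t => PowerSeries.coeff k (R t i j)) V) :
    ∃ S : Matrix (Fin N) (Fin N) (Hol V)⟦X⟧, Represents S R := by
  refine ⟨Matrix.of fun i j => PowerSeries.mk fun k => mk _ (h k i j), fun t => ?_⟩
  ext i j k
  rw [Matrix.map_apply, coeff_evS, Matrix.of_apply, PowerSeries.coeff_mk, ev_mk]

theorem Represents.ev_coeff (h : Represents S R) (i j : Fin N) (k : ℕ) (t : V) :
    ev t (PowerSeries.coeff k (S i j)) = PowerSeries.coeff k (R t i j) := by
  rw [h t, Matrix.map_apply, coeff_evS]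

theorem Represents.analyticOnNhd (hV : IsOpen V) (h : Represents S R) (k : ℕ) (i j : Fin N) :
    AnalyticOnNhd ℂ (fun t => PowerSeries.coeff k (R t i j)) V :=
  (analyticOnNhd_rep (PowerSeries.coeff k (S i j))).congr hV fun t ht => by
    rw [← ev_eq_rep _ ⟨t, ht⟩, h.ev_coeff]

theorem Represents.pd (hV : IsOpen V) (h : Represents S R) (α : Fin N) :
    Represents (S.map (PowerSeries.coeffDerivation (partialDer hV α))) (MatrixSeries.pd α R) := by
  intro t
  ext i j k
  rw [Matrix.map_apply, Matrix.map_apply, coeff_evS, PowerSeries.coeff_coeffDerivation,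
    ev_partialDer hV α (F := fun x => PowerSeries.coeff k (R x i j)) (h.ev_coeff i j k),
    MatrixSeries.pd, Matrix.of_apply, PowerSeries.coeff_mk]

theorem isUnitary_iff (h : Represents S R) : IsUnitary V R ↔ S * PowerSeries.reflect S = 1 := by
  constructor
  · intro hR
    refine series_ext fun t => ?_
    rw [evS_map_mul, evS_map_reflect, ← h t, hR t t.2]
    exact (Matrix.map_one _ (map_zero _) (map_one _)).symm
  · intro hS t ht
    have := congrArg (fun Y : Matrix (Fin N) (Fin N) (Hol V)⟦X⟧ => Y.map (evS ⟨t, ht⟩)) hS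
    simp only [evS_map_mul, evS_map_reflect, ← h ⟨t, ht⟩] at this
    rw [this]
    exact Matrix.map_one _ (map_zero _) (map_one _)

theorem zeroth_iff (h : Represents S R) :
    (∀ t ∈ V, (R t).map PowerSeries.constantCoeff = 1) ↔ PowerSeries.coeffMat 0 S = 1 := by
  have h1 : ∀ t : V, (R t).map PowerSeries.constantCoeff
      = (PowerSeries.coeffMat 0 S).map (ev t) := by
    intro t
    ext i j
    rw [Matrix.map_apply, ← PowerSeries.coeff_zero_eq_constantCoeff_apply, ← h.ev_coeff]
    rfl
  have h2 : ∀ t : V, (1 : Matrix (Fin N) (Fin N) (Hol V)).map (ev t) = 1 := fun t =>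
    Matrix.map_one _ (map_zero _) (map_one _)
  constructor
  · intro hR
    refine matrix_ext fun t => ?_
    rw [← h1, hR t t.2, h2]
  · intro hS t ht
    rw [h1 ⟨t, ht⟩, hS, h2]

end Hol

/-! ### Translation between analytic and algebraic solutions -/

namespace IsCanonicalCoordinates

open Hol

variable {N : ℕ} {Fr : FrobeniusStructure N} {V : Set (Pt N)} {u s : Fin N → Pt N → ℂ}
  {S : Matrix (Fin N) (Fin N) (Hol V)⟦X⟧} {R : MatrixSeries N}

theorem frame_Ψ_map_ev (hV : IsOpen V) (hc : Convex ℝ V)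
    (hu : IsCanonicalCoordinates Fr V u) (hs : IsInvSqrtHessian Fr V u s) (t : V) :
    (hu.frame hV hc hs).Ψ.map (ev t) = transition u s t := by
  ext β i
  change ev t (Hol.mk (s i) (hs i).1 * partialDer hV β (Hol.mk (u i) (hu.analytic i))) = _
  rw [map_mul, ev_partialDer hV β (ev_mk _ _), ev_mk]
  rfl

theorem frame_D_map_ev (hV : IsOpen V) (hc : Convex ℝ V)
    (hu : IsCanonicalCoordinates Fr V u) (hs : IsInvSqrtHessian Fr V u s) (α : Fin N) (t : V) :
    ((hu.frame hV hc hs).D α).map (ev t) = Matrix.diagonal fun i => pd α (u i) t := by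
  rw [CanonicalFrame.D, Matrix.diagonal_map (map_zero _)]
  congr 1
  funext i
  exact ev_partialDer hV α (ev_mk (u i) (hu.analytic i)) t

theorem isAsymptoticSolution_iff (hV : IsOpen V) (hc : Convex ℝ V)
    (hu : IsCanonicalCoordinates Fr V u) (hs : IsInvSqrtHessian Fr V u s)
    (h : Represents S R) :
    IsAsymptoticSolution Fr V u s R ↔
      (hu.frame hV hc hs).toConnection.IsSolution S ∧ PowerSeries.coeffMat 0 S = 1 := by
  set c := hu.frame hV hc hs with hcdef
  have hΨ : Represents (c.Ψ.map PowerSeries.C * S) (asymptoticS u s R).amp := by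
    intro t
    rw [evS_map_mul, evS_map_C, frame_Ψ_map_ev, ← h t]
    rfl
  have hX : ∀ (t : V) (Y : Matrix (Fin N) (Fin N) (Hol V)⟦X⟧),
      ((PowerSeries.X : (Hol V)⟦X⟧) • Y).map (evS t) = (PowerSeries.X : ℂ⟦X⟧) • Y.map (evS t) := by
    intro t Y
    ext1 i j
    simp [evS]
  have hadd : ∀ (t : V) (Y Z : Matrix (Fin N) (Fin N) (Hol V)⟦X⟧),
      (Y + Z).map (evS t) = Y.map (evS t) + Z.map (evS t) := fun t Y Z =>
    Matrix.map_add _ (map_add _) _ _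
  have hl : ∀ (α : Fin N) (t : V), ((asymptoticS u s R).zderiv α).amp t
      = ((PowerSeries.X : (Hol V)⟦X⟧) • (c.Ψ.map PowerSeries.C * S).map
          (PowerSeries.coeffDerivation (c.der α))
        + c.Ψ.map PowerSeries.C * S * (c.D α).map PowerSeries.C).map (evS t) := by
    intro α t
    rw [hadd, hX, evS_map_mul, evS_map_C, frame_D_map_ev, ← hΨ t]
    exact congrArg (fun Y => (PowerSeries.X : ℂ⟦X⟧) • Y + _) (hΨ.pd hV α t)
  have hr : ∀ (α : Fin N) (t : V), ((asymptoticS u s R).lmul (Fr.connMatrix α)).amp t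
      = ((c.C α).map PowerSeries.C * (c.Ψ.map PowerSeries.C * S)).map (evS t) := by
    intro α t
    rw [evS_map_mul, evS_map_C, ← hΨ t]
    have : (c.C α).map (ev t) = Fr.connMatrix α t := conn_map_ev Fr hV hu.subset_dom α t
    rw [this]
    rfl
  rw [CanonicalFrame.isSolution_iff, ← zeroth_iff h]
  constructor
  · rintro ⟨-, h0, h1, -⟩
    refine ⟨fun α => series_ext fun t => ?_, h0⟩
    rw [← hl, ← hr]
    exact (h1 α).2 t.2
  · rintro ⟨h1, h0⟩
    refine ⟨h.analyticOnNhd hV, h0, fun α => ⟨rfl, fun t ht => ?_⟩, fun t ht => ?_⟩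
    · rw [hl α ⟨t, ht⟩, hr α ⟨t, ht⟩, h1]
    · have h2 : (constSeries (transition u s t)).map PowerSeries.constantCoeff
          = transition u s t := by
        ext i j
        simp [constSeries]
      -- Fundamentality is automatic: the determinant of ΨR has constant term det Ψ, and (det Ψ)² =
      -- det g.
      have h3 : IsUnit (transition u s t).det := by
        have h4 := congrArg Matrix.det (hu.transition_mul_transpose hs ht)
        rw [Matrix.det_mul] at h4
        exact isUnit_of_mul_isUnit_left (h4 ▸ Fr.g_nondeg)
      rw [PowerSeries.isUnit_iff_constantCoeff, RingHom.map_det, RingHom.mapMatrix_apply]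
      change IsUnit ((constSeries (transition u s t) * R t).map PowerSeries.constantCoeff).det
      rw [Matrix.map_mul, h0 t ht, mul_one, h2]
      exact h3

/-- The components of a holomorphic vector field. -/
def field {E : Pt N → Pt N} (hE : AnalyticOnNhd ℂ E V) (β : Fin N) : Hol V :=
  Hol.mk (fun t => E t β) fun t ht =>
    ((ContinuousLinearMap.proj β : Pt N →L[ℂ] ℂ).analyticAt _).comp (hE t ht)

theorem ev_fieldDer (hV : IsOpen V) (hc : Convex ℝ V)
    (hu : IsCanonicalCoordinates Fr V u) (hs : IsInvSqrtHessian Fr V u s)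
    {E : Pt N → Pt N} (hE : AnalyticOnNhd ℂ E V) {f : Hol V} {F : Pt N → ℂ}
    (h : ∀ t : V, ev t f = F t) (t : V) :
    ev t ((hu.frame hV hc hs).fieldDer (field hE) f) = fderiv ℂ F t (E t) := by
  rw [CanonicalFrame.fieldDer_apply, map_sum, fderiv_apply_eq_sum]
  refine Finset.sum_congr rfl fun β _ => ?_
  rw [map_mul]
  exact congrArg (E t β * ·) (ev_partialDer hV β h t)

theorem isHomogeneous_iff (hV : IsOpen V) (hc : Convex ℝ V)
    (hu : IsCanonicalCoordinates Fr V u) (hs : IsInvSqrtHessian Fr V u s)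
    {E : Pt N → Pt N} (hE : AnalyticOnNhd ℂ E V) (h : Represents S R) :
    IsHomogeneous V E R ↔
      S.map (PowerSeries.eulerDerivation ((hu.frame hV hc hs).fieldDer (field hE))) = 0 := by
  have h1 : ∀ (t : V) (k : ℕ) (i j : Fin N), ev t (PowerSeries.coeff k
      (PowerSeries.eulerDerivation ((hu.frame hV hc hs).fieldDer (field hE)) (S i j)))
      = k * PowerSeries.coeff k (R t i j)
        + fderiv ℂ (fun x => PowerSeries.coeff k (R x i j)) t (E t) := by
    intro t k i j
    rw [PowerSeries.coeff_eulerDerivation, map_add, map_mul, map_natCast, h.ev_coeff,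
      ev_fieldDer hV hc hu hs hE (F := fun x => PowerSeries.coeff k (R x i j)) (h.ev_coeff i j k)]
  constructor
  · intro hR
    ext1 i j
    refine PowerSeries.ext fun k => ext_ev fun t => ?_
    rw [Matrix.map_apply, h1, hR t t.2]
    simp
  · intro hS t ht k i j
    have := h1 ⟨t, ht⟩ k i j
    rw [show PowerSeries.eulerDerivation _ (S i j) = 0 from congrFun (congrFun hS i) j, map_zero,
      map_zero] at this
    linear_combination -this

end IsCanonicalCoordinates

/-! ### Solutions over a convex open set with canonical coordinates -/

namespace IsCanonicalCoordinates

open Hol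

variable {N : ℕ} {Fr : FrobeniusStructure N} {V : Set (Pt N)} {u s : Fin N → Pt N → ℂ}

theorem exists_unitary_solution (hV : IsOpen V) (hc : Convex ℝ V) (hne : V.Nonempty)
    (hu : IsCanonicalCoordinates Fr V u) (hs : IsInvSqrtHessian Fr V u s) :
    ∃ R : MatrixSeries N, IsAsymptoticSolution Fr V u s R ∧ IsUnitary V R := by
  have : Nonempty V := hne.to_subtype
  obtain ⟨S, hS, hS0, hSu⟩ := (hu.frame hV hc hs).toConnection.exists_isSolution_unitary
  obtain ⟨R, hR⟩ := Hol.exists_represents S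
  exact ⟨R, (hu.isAsymptoticSolution_iff hV hc hs hR).mpr ⟨hS, hS0⟩, (isUnitary_iff hR).mpr hSu⟩

theorem unitary_solution_iff (hV : IsOpen V) (hc : Convex ℝ V) (hne : V.Nonempty)
    (hu : IsCanonicalCoordinates Fr V u) (hs : IsInvSqrtHessian Fr V u s)
    {R : MatrixSeries N} (hR : IsAsymptoticSolution Fr V u s R) (hRu : IsUnitary V R)
    (R' : MatrixSeries N) :
    (IsAsymptoticSolution Fr V u s R' ∧ IsUnitary V R') ↔
      ∃ a : ℕ → Fin N → ℂ, ∀ t ∈ V, R' t = R t * diagExp a := by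
  have : Nonempty V := hne.to_subtype
  obtain ⟨S, hS⟩ := Hol.exists_represented hR.analytic
  have h := (hu.isAsymptoticSolution_iff hV hc hs hS).mp hR
  have hmul : ∀ (a : ℕ → Fin N → ℂ) (t : V),
      (S * PowerSeries.constDiag (Hol V) fun i => (PowerSeries.exp ℂ).subst
        (PowerSeries.mk fun m => if Odd m then a (m / 2) i else 0 : ℂ⟦X⟧)).map (evS t)
      = R t * diagExp a := by
    intro a t
    rw [evS_map_mul, evS_map_constDiag, ← hS t]
    rfl
  constructor
  · rintro ⟨hR', hRu'⟩
    obtain ⟨S', hS'⟩ := Hol.exists_represented hR'.analytic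
    have h' := (hu.isAsymptoticSolution_iff hV hc hs hS').mp hR'
    obtain ⟨a, ha⟩ := (CoordinateConnection.isSolution_unitary_iff h.1 h.2
      ((isUnitary_iff hS).mp hRu)).mp ⟨h'.1, h'.2, (isUnitary_iff hS').mp hRu'⟩
    refine ⟨a, fun t ht => ?_⟩
    rw [hS' ⟨t, ht⟩, ha, hmul]
  · rintro ⟨a, ha⟩
    obtain ⟨h1, h2, h3⟩ := (CoordinateConnection.isSolution_unitary_iff h.1 h.2
      ((isUnitary_iff hS).mp hRu)).mpr ⟨a, rfl⟩
    have hrep : Represents (S * PowerSeries.constDiag (Hol V) fun i => (PowerSeries.exp ℂ).subst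
        (PowerSeries.mk fun m => if Odd m then a (m / 2) i else 0 : ℂ⟦X⟧)) R' := fun t => by
      rw [hmul, ha t t.2]
    exact ⟨(hu.isAsymptoticSolution_iff hV hc hs hrep).mpr ⟨h1, h2⟩, (isUnitary_iff hrep).mpr h3⟩

theorem pairing_single_right (g : Matrix (Fin N) (Fin N) ℂ) (a : Pt N) (β : Fin N) :
    pairing g a (Pi.single β 1) = ∑ γ, g γ β * a γ := by
  simp [pairing, Pi.single_apply]

theorem pairing_single_left (g : Matrix (Fin N) (Fin N) ℂ) (a : Pt N) (α : Fin N) :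
    pairing g (Pi.single α 1) a = ∑ γ, g α γ * a γ := by
  simp [pairing, Pi.single_apply]

/-- Evaluate the tensor equations on the constant fields φ_α, φ_β; since [E, φ_α] = -∂_α E, only the
matrix ∂E and the derivative of C_α along E remain. -/
theorem isEuler (hV : IsOpen V) (hc : Convex ℝ V)
    (hu : IsCanonicalCoordinates Fr V u) (hs : IsInvSqrtHessian Fr V u s)
    {E : Pt N → Pt N} {d : ℂ} (hE : IsEulerField Fr E d)
    (hEV : AnalyticOnNhd ℂ E V) :
    (hu.frame hV hc hs).IsEuler (field hEV) d := by
  set c := hu.frame hV hc hs with hcdef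
  have hM : ∀ (t : V) (α β : Fin N), ev t (c.fieldJac (field hEV) α β)
      = fderiv ℂ E t (Pi.single α 1) β := by
    intro t α β
    have h1 : ev t (c.fieldJac (field hEV) α β) = pd α (fun x => E x β) t :=
      ev_partialDer hV α (fun _ => rfl) t
    rw [h1, pd, fderiv_apply (hEV t t.2).differentiableAt]
    rfl
  have hEw : ∀ (t : V) (w : Pt N) (ν : Fin N), fderiv ℂ E t w ν
      = ∑ μ, w μ * ev t (c.fieldJac (field hEV) μ ν) := by
    intro t w ν
    simp only [hM]
    conv_lhs => rw [pi_eq_sum_univ' w]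
    simp
  have hconst : ∀ (t : V) (a : Pt N), VectorField.lieBracket ℂ E (fun _ => a) t
      = -fderiv ℂ E t a := by
    intro t a
    simp [VectorField.lieBracket]
  refine ⟨?_, fun α => ?_⟩
  · refine matrix_ext fun t => ?_
    ext α β
    have h := hE.lie_metric t (hu.subset_dom t.2) (Pi.single α 1) (Pi.single β 1)
    rw [hconst, hconst, pairing_single_right _ (-_), pairing_single_left _ (-_),
      pairing_single_right] at h
    have hg : ∀ γ δ, ev t (c.g γ δ) = Fr.g γ δ := fun γ δ => AlgHom.commutes _ _
    simp only [Matrix.map_apply, Matrix.add_apply, Matrix.mul_apply, Matrix.transpose_apply,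
      Matrix.smul_apply, map_add, map_sum, map_mul, map_smul, hg, hM, smul_eq_mul]
    simp only [fderiv_fun_const, Pi.zero_apply, _root_.zero_apply, Pi.neg_apply,
      mul_neg, Finset.sum_neg_distrib, Pi.single_apply, mul_ite, mul_one, mul_zero,
      Finset.sum_ite_eq', Finset.mem_univ, if_true] at h
    simp only [mul_comm _ (Fr.g _ _)]
    rw [mul_comm (Fr.g _ _)]
    linear_combination h
  · refine matrix_ext fun t => ?_
    ext β ν
    have h := congrFun (hE.lie_mul t (hu.subset_dom t.2) (Pi.single α 1) (Pi.single β 1)) ν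
    rw [hconst, hconst] at h
    have hC : ∀ (x : V) (α β ν : Fin N), ev x (c.C α β ν) = Fr.connMatrix α x β ν :=
      fun x α β ν => congrFun (congrFun (conn_map_ev Fr hV hu.subset_dom α x) β) ν
    have hmulr : ∀ (x : Pt N) (a : Pt N) (ν : Fin N), Fr.mul x a (Pi.single β 1) ν
        = ∑ μ, a μ * Fr.connMatrix μ x β ν := by
      intro x a ν
      simp [Fr.mul_apply, Pi.single_apply]
    have hmull : ∀ (x : Pt N) (b : Pt N) (ν : Fin N), Fr.mul x (Pi.single α 1) b ν
        = ∑ μ, b μ * Fr.connMatrix α x μ ν := by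
      intro x b ν
      simp [Fr.mul_apply, Pi.single_apply]
    have hm : ∀ (x : Pt N) (ν : Fin N), Fr.mul x (Pi.single α 1) (Pi.single β 1) ν
        = Fr.connMatrix α x β ν := by
      intro x ν
      simp [hmulr, Pi.single_apply]
    have hd : DifferentiableAt ℂ (fun x => Fr.mul x (Pi.single α 1) (Pi.single β 1)) t := by
      refine differentiableAt_pi.mpr fun ν => ?_
      simp only [hm]
      refine ((analyticOnNhd_rep (c.C α β ν)).congr hV fun x hx => ?_) t t.2 |>.differentiableAt
      rw [← ev_eq_rep _ ⟨x, hx⟩, hC]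
    have h1 : ev t (c.fieldDer (field hEV) (c.C α β ν))
        = fderiv ℂ (fun x => Fr.mul x (Pi.single α 1) (Pi.single β 1)) t (E t) ν := by
      rw [hu.ev_fieldDer hV hc hs hEV (F := fun x => Fr.connMatrix α x β ν)
        fun x => hC x α β ν]
      simp only [← hm]
      rw [fderiv_apply hd]
      rfl
    simp only [VectorField.lieBracket, Pi.sub_apply, ← h1, hEw, hmulr _ (-_), hmull _ (-_), hm,
      Pi.neg_apply, neg_mul, Finset.sum_neg_distrib] at h
    simp only [Pi.single_apply, ite_mul, one_mul, zero_mul, Finset.sum_ite_eq', Finset.mem_univ,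
      if_true] at h
    simp only [Matrix.map_apply, Matrix.add_apply, Matrix.sub_apply, Matrix.mul_apply,
      Matrix.sum_apply, Matrix.smul_apply, map_add, map_sub, map_sum, map_mul, smul_eq_mul, hC]
    linear_combination h

theorem exists_homogeneous_solution (hV : IsOpen V) (hc : Convex ℝ V) (hne : V.Nonempty)
    (hu : IsCanonicalCoordinates Fr V u) (hs : IsInvSqrtHessian Fr V u s)
    {E : Pt N → Pt N} {d : ℂ} (hE : IsEulerField Fr E d) :
    ∃ R : MatrixSeries N,
      IsAsymptoticSolution Fr V u s R ∧ IsHomogeneous V E R ∧ IsUnitary V R ∧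
      ∀ R' : MatrixSeries N, IsAsymptoticSolution Fr V u s R' → IsHomogeneous V E R' →
        Set.EqOn R' R V := by
  have : Nonempty V := hne.to_subtype
  have hEV := hE.analytic.mono hu.subset_dom
  obtain ⟨S, hS, hS0, hSu, hSL, huniq⟩ := CoordinateConnection.exists_isSolution_homogeneous
    (hu.isEuler hV hc hs hE hEV).isHomogeneousDerivation
  obtain ⟨R, hR⟩ := Hol.exists_represents S
  refine ⟨R, (hu.isAsymptoticSolution_iff hV hc hs hR).mpr ⟨hS, hS0⟩,
    (hu.isHomogeneous_iff hV hc hs hEV hR).mpr hSL, (isUnitary_iff hR).mpr hSu,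
    fun R' hR' hL' t ht => ?_⟩
  obtain ⟨S', hS'⟩ := Hol.exists_represented hR'.analytic
  have h' := (hu.isAsymptoticSolution_iff hV hc hs hS').mp hR'
  rw [hS' ⟨t, ht⟩, hR ⟨t, ht⟩,
    huniq S' h'.1 h'.2 ((hu.isHomogeneous_iff hV hc hs hEV hS').mp hL')]

end IsCanonicalCoordinates

/-! ### The idempotents at a semisimple point -/

theorem IsSemisimpleRing.exists_algEquiv_pi_of_isAlgClosed (k R : Type*) [Field k] [IsAlgClosed k]
    [CommRing R] [Algebra k R] [FiniteDimensional k R] [IsSemisimpleRing R] :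
    ∃ n : ℕ, Nonempty (R ≃ₐ[k] (Fin n → k)) := by
  obtain ⟨n, d, hd, ⟨e⟩⟩ := IsSemisimpleRing.exists_algEquiv_pi_matrix_of_isAlgClosed k R
  refine ⟨n, ⟨e.trans (AlgEquiv.piCongrRight fun i =>
    (AlgEquiv.ofBijective (Algebra.ofId k (Matrix (Fin (d i)) (Fin (d i)) k)) ?_).symm)⟩⟩
  have hcomm : ∀ x y : Π i, Matrix (Fin (d i)) (Fin (d i)) k, x * y = y * x := fun x y => by
    rw [← e.apply_symm_apply x, ← e.apply_symm_apply y, ← map_mul, mul_comm, map_mul]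
  have hsub : ∀ a b : Fin (d i), a = b := by
    intro a b
    by_contra hab
    -- For a ≠ b, E_ab E_bb = E_ab while E_bb E_ab = 0, so commutativity forces blocks of size one.
    have h := congrFun (hcomm (Pi.single i (Matrix.single a b 1))
      (Pi.single i (Matrix.single b b 1))) i
    simp only [Pi.mul_apply, Pi.single_eq_same, Matrix.single_mul_single_same, mul_one] at h
    rw [Matrix.single_mul_single_of_ne _ _ _ _ (Ne.symm hab)] at h
    have := congrFun (congrFun h a) b
    simp at this
  have := hd i
  refine ⟨(algebraMap k _).injective, fun M => ⟨M 0 0, ?_⟩⟩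
  ext a b
  rw [hsub a 0, hsub b 0]
  simp [Algebra.ofId_apply, Matrix.algebraMap_matrix_apply]

namespace FrobeniusStructure

variable {N : ℕ} (Fr : FrobeniusStructure N)

theorem smul_mul' (t : Pt N) (c : ℂ) (a b : Pt N) : Fr.mul t (c • a) b = c • Fr.mul t a b := by
  funext ν
  simp only [mul_apply, Pi.smul_apply, smul_eq_mul, mul_assoc, Finset.mul_sum]

theorem mul_smul' (t : Pt N) (c : ℂ) (a b : Pt N) : Fr.mul t a (c • b) = c • Fr.mul t a b := by
  funext ν
  simp only [mul_apply, Pi.smul_apply, smul_eq_mul, mul_assoc, Finset.mul_sum, mul_left_comm c]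

instance (t : Fr.dom) : Module ℂ (Fr.TangentAlgebra t) := inferInstanceAs (Module ℂ (Pt N))

instance (t : Fr.dom) : FiniteDimensional ℂ (Fr.TangentAlgebra t) :=
  inferInstanceAs (FiniteDimensional ℂ (Pt N))

noncomputable instance (t : Fr.dom) : Algebra ℂ (Fr.TangentAlgebra t) :=
  Algebra.ofModule (fun c a b => Fr.smul_mul' t c a b) fun c a b => Fr.mul_smul' t c a b

theorem exists_idempotents (p : Fr.dom) (hp : Fr.IsSemisimpleAt p) :
    ∃ J K : Matrix (Fin N) (Fin N) ℂ, J * K = 1 ∧ ∀ i j,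
      Fr.mul p (fun β => K β i) (fun β => K β j) = if i = j then fun β => K β i else 0 := by
  have : IsSemisimpleRing (Fr.TangentAlgebra p) := hp
  obtain ⟨n, ⟨e⟩⟩ := IsSemisimpleRing.exists_algEquiv_pi_of_isAlgClosed ℂ (Fr.TangentAlgebra p)
  obtain rfl : N = n := by
    have h1 := e.toLinearEquiv.finrank_eq
    rw [Module.finrank_fin_fun] at h1
    rw [← h1]
    exact (Module.finrank_fin_fun ℂ).symm
  obtain ⟨f, hf⟩ : ∃ f : Pt N ≃ₗ[ℂ] (Fin N → ℂ), ∀ a b, f (Fr.mul p a b) = f a * f b :=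
    ⟨e.toLinearEquiv, map_mul (M := Fr.TangentAlgebra p) e⟩
  refine ⟨LinearMap.toMatrix' f.toLinearMap, LinearMap.toMatrix' f.symm.toLinearMap, ?_, ?_⟩
  · rw [← LinearMap.toMatrix'_comp]
    simp
  · have h1 : ∀ i, (fun β => LinearMap.toMatrix' f.symm.toLinearMap β i)
        = f.symm (Pi.single i 1) := fun i => by
      funext β
      simp [LinearMap.toMatrix'_apply]
    intro i j
    rw [h1, h1]
    apply f.injective
    rw [hf]
    split_ifs with hij
    · rw [hij]
      simp [← Pi.single_mul]
    · rw [map_zero, f.apply_symm_apply, f.apply_symm_apply]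
      funext k
      simp only [Pi.mul_apply, Pi.single_apply, Pi.zero_apply]
      split_ifs <;> simp_all

/-! ### Idempotent vector fields near a semisimple point -/

/-- The zeros in the second variable are the idempotents at a given point. The exponent ⊤ means
analytic, so that the implicit function is analytic too. -/
theorem contDiffAt_mul {p : Pt N} (hp : p ∈ Fr.dom) (x : Pt N) :
    ContDiffAt ℂ ⊤ (fun y : Pt N × Pt N => Fr.mul y.1 y.2 y.2 - y.2) (p, x) := by
  have h3 : ∀ α β μ, AnalyticOnNhd ℂ (third Fr.F α β μ) Fr.dom := fun α β μ =>
    ((Fr.analytic_F.fderiv_apply _).fderiv_apply _).fderiv_apply _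
  have h1 : ContDiffAt ℂ ⊤ (fun y : Pt N × Pt N => y.2) (p, x) := contDiffAt_snd
  have h2 : ∀ α, ContDiffAt ℂ ⊤ (fun y : Pt N × Pt N => y.2 α) (p, x) := contDiffAt_pi.mp h1
  refine ContDiffAt.sub ?_ h1
  rw [contDiffAt_pi]
  intro ν
  simp only [mul, frobMul]
  refine ContDiffAt.sum fun α _ => ContDiffAt.sum fun β _ => ContDiffAt.sum fun μ _ => ?_
  refine (((h2 α).mul (h2 β)).mul ?_).mul contDiffAt_const
  exact (h3 α β μ p hp).contDiffAt.comp (p, x) contDiffAt_fst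

/-- Implicit function theorem for x • x - x, whose derivative at e is v ↦ 2 e • v - v. If it kills
v, multiplication by e gives e • v = 2 e • v, so e • v = 0 and then v = 0. -/
theorem exists_idempotent_field {p : Pt N} (hp : p ∈ Fr.dom) {e : Pt N} (he : Fr.mul p e e = e) :
    ∃ x : Pt N → Pt N, AnalyticAt ℂ x p ∧ x p = e ∧
      ∀ᶠ t in nhds p, Fr.mul t (x t) (x t) = x t := by
  have hcd := Fr.contDiffAt_mul hp e
  set f : Pt N × Pt N → Pt N := fun y => Fr.mul y.1 y.2 y.2 - y.2 with hf
  have hder : ∀ v, fderiv ℂ f (p, e) (0, v) = (2 : ℂ) • Fr.mul p e v - v := by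
    intro v
    have h1 : HasDerivAt (fun τ : ℂ => ((p, e + τ • v) : Pt N × Pt N)) (0, v) 0 := by
      refine (hasDerivAt_const (0 : ℂ) p).prodMk ?_
      simpa using ((hasDerivAt_id (0 : ℂ)).smul_const v).const_add e
    have h2 : HasDerivAt (fun τ : ℂ => f (p, e + τ • v)) (fderiv ℂ f (p, e) (0, v)) 0 := by
      refine HasFDerivAt.comp_hasDerivAt (0 : ℂ) (l := f) ?_ h1
      simpa using (hcd.differentiableAt (by simp)).hasFDerivAt
    have h3 : (fun τ : ℂ => f (p, e + τ • v))
        = fun τ => τ • ((2 : ℂ) • Fr.mul p e v - v) + τ ^ 2 • Fr.mul p v v := by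
      funext τ
      have hc : Fr.mul p v e = Fr.mul p e v := Fr.mul_comm' p hp v e
      simp only [hf, mul_add', add_mul', smul_mul', mul_smul', he, hc]
      module
    have h4 : HasDerivAt (fun τ : ℂ => f (p, e + τ • v)) ((2 : ℂ) • Fr.mul p e v - v) 0 := by
      rw [h3]
      simpa using ((hasDerivAt_id (0 : ℂ)).smul_const ((2 : ℂ) • Fr.mul p e v - v)).fun_add
        (((hasDerivAt_id (0 : ℂ)).pow 2).smul_const (Fr.mul p v v))
    exact h2.unique h4
  have hinj : Function.Injective (fderiv ℂ f (p, e) ∘L .inr ℂ (Pt N) (Pt N)) := by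
    refine (injective_iff_map_eq_zero _).mpr fun v hv => ?_
    have h1 : (2 : ℂ) • Fr.mul p e v = v := by
      rw [← sub_eq_zero, ← hder]
      exact hv
    have h2 : Fr.mul p e (Fr.mul p e v) = Fr.mul p e v := by
      have : Fr.mul p (Fr.mul p e e) v = Fr.mul p e (Fr.mul p e v) := Fr.mul_assoc' p hp e e v
      rw [← this, he]
    have h3 : Fr.mul p e v = (2 : ℂ) • Fr.mul p e v := by
      conv_lhs => rw [← h1, mul_smul', h2]
    have h4 : Fr.mul p e v = 0 := by
      rw [two_smul] at h3
      exact left_eq_add.mp h3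
    rw [← h1, h4, smul_zero]
  have hinv : (fderiv ℂ f (p, e) ∘L .inr ℂ (Pt N) (Pt N)).IsInvertible := by
    refine ⟨(LinearEquiv.ofInjectiveEndo
      ((fderiv ℂ f (p, e) ∘L .inr ℂ (Pt N) (Pt N)) : Pt N →ₗ[ℂ] Pt N) hinj).toContinuousLinearEquiv,
      ?_⟩
    ext1 v
    rfl
  refine ⟨hcd.implicitFunction (by simp) hinv, ?_, hcd.implicitFunction_apply_self _ _, ?_⟩
  · exact (hcd.contDiffAt_implicitFunction (by simp) hinv).analyticAt
  · filter_upwards [hcd.eventually_apply_implicitFunction (by simp) hinv] with t ht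
    rw [← sub_eq_zero]
    refine Eq.trans ht ?_
    rw [hf]
    simp [he]

/-- An idempotent close to zero vanishes. -/
theorem eventually_eq_zero_of_idempotent {p : Pt N} (hp : p ∈ Fr.dom) {y : Pt N → Pt N}
    (hy : ContinuousAt y p) (hy0 : y p = 0)
    (h : ∀ᶠ t in nhds p, Fr.mul t (y t) (y t) = y t) : ∀ᶠ t in nhds p, y t = 0 := by
  have h3 : ∀ α β μ, ContinuousAt (third Fr.F α β μ) p := fun α β μ =>
    ((((Fr.analytic_F.fderiv_apply _).fderiv_apply _).fderiv_apply _) p hp).continuousAt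
  have hC : ∀ α, ContinuousAt (Fr.connMatrix α) p := fun α =>
    continuousAt_pi.mpr fun β => continuousAt_pi.mpr fun ν => by
      simp only [connMatrix, Matrix.of_apply]
      exact tendsto_finsetSum _ fun μ _ => (h3 α β μ).mul continuousAt_const
  -- The equation y • y = y says that the row vector y is annihilated by 1 - (y •), which is the
  -- identity at p and so invertible nearby.
  set M : Pt N → Matrix (Fin N) (Fin N) ℂ := fun t => 1 - ∑ α, y t α • Fr.connMatrix α t with hM
  have hMc : ContinuousAt M p := by
    refine continuousAt_const.sub (tendsto_finsetSum _ fun α _ => ?_)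
    exact (continuousAt_pi.mp hy α).smul (hC α)
  have hdet : ContinuousAt (fun t => (M t).det) p :=
    (Continuous.matrix_det continuous_id).continuousAt.comp hMc
  have hp1 : (M p).det ≠ 0 := by simp [hM, hy0]
  filter_upwards [h, hdet.eventually_ne hp1] with t ht hdt
  refine Matrix.eq_zero_of_vecMul_eq_zero hdt ?_
  rw [hM]
  simp only [Matrix.vecMul_sub, Matrix.vecMul_one, sub_eq_zero]
  refine ht.symm.trans ?_
  funext ν
  rw [mul_apply]
  simp only [Matrix.vecMul, dotProduct, Matrix.sum_apply, Matrix.smul_apply, smul_eq_mul,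
    Finset.mul_sum]
  rw [Finset.sum_comm]
  refine Finset.sum_congr rfl fun α _ => Finset.sum_congr rfl fun β _ => ?_
  ring

theorem analyticAt_mul {p : Pt N} (hp : p ∈ Fr.dom) {x y : Pt N → Pt N} (hx : AnalyticAt ℂ x p)
    (hy : AnalyticAt ℂ y p) : AnalyticAt ℂ (fun t => Fr.mul t (x t) (y t)) p := by
  have h3 : ∀ α β μ, AnalyticAt ℂ (third Fr.F α β μ) p := fun α β μ =>
    (((Fr.analytic_F.fderiv_apply _).fderiv_apply _).fderiv_apply _) p hp
  refine AnalyticAt.pi fun ν => ?_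
  simp only [mul, frobMul]
  refine Finset.analyticAt_fun_sum _ fun α _ => Finset.analyticAt_fun_sum _ fun β _ =>
    Finset.analyticAt_fun_sum _ fun μ _ => ?_
  have hx' : AnalyticAt ℂ (fun t => x t α) p := analyticAt_pi_iff.mp hx α
  have hy' : AnalyticAt ℂ (fun t => y t β) p := analyticAt_pi_iff.mp hy β
  exact ((hx'.mul hy').mul (h3 α β μ)).mul analyticAt_const

/-- A frame of orthogonal idempotent vector fields near a semisimple point. -/
theorem exists_idempotent_frame (p : Fr.dom) (hp : Fr.IsSemisimpleAt p) :
    ∃ K : Pt N → Matrix (Fin N) (Fin N) ℂ, (∀ β i, AnalyticAt ℂ (fun t => K t β i) p) ∧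
      ∀ᶠ t in nhds (p : Pt N), (K t).det ≠ 0 ∧ ∀ i j,
        Fr.mul t (fun β => K t β i) (fun β => K t β j)
          = if i = j then fun β => K t β i else 0 := by
  obtain ⟨J₀, K₀, hJK, h⟩ := Fr.exists_idempotents p hp
  choose x hxa hxp hx using fun i =>
    Fr.exists_idempotent_field p.2 ((h i i).trans (if_pos rfl))
  have hxa' : ∀ β i, AnalyticAt ℂ (fun t => x i t β) p := fun β i =>
    analyticAt_pi_iff.mp (hxa i) β
  refine ⟨fun t => Matrix.of fun β i => x i t β, hxa', ?_⟩
  have hdet : ∀ᶠ t in nhds (p : Pt N), (Matrix.of fun β i => x i t β).det ≠ 0 := by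
    have hc : ContinuousAt (fun t => (Matrix.of fun β i => x i t β)) p :=
      continuousAt_pi.mpr fun β => continuousAt_pi.mpr fun i => (hxa' β i).continuousAt
    have hc' : ContinuousAt (fun t => (Matrix.of fun β i => x i t β).det) p :=
      (Continuous.matrix_det continuous_id).continuousAt.comp hc
    refine hc'.eventually_ne ?_
    have h0 : (Matrix.of fun β i => x i p β) = K₀ := by
      ext β i
      rw [Matrix.of_apply, hxp]
    rw [h0]
    intro h1
    have := congrArg Matrix.det hJK
    rw [Matrix.det_mul, h1, mul_zero, Matrix.det_one] at this
    exact zero_ne_one this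
  -- The product of two commuting idempotents is an idempotent; it vanishes at p and therefore near
  -- p.
  have horth : ∀ i j, i ≠ j → ∀ᶠ t in nhds (p : Pt N), Fr.mul t (x i t) (x j t) = 0 := by
    intro i j hij
    refine Fr.eventually_eq_zero_of_idempotent p.2
      (Fr.analyticAt_mul p.2 (hxa i) (hxa j)).continuousAt ?_ ?_
    · rw [hxp, hxp, h, if_neg hij]
    · filter_upwards [hx i, hx j, Fr.isOpen_dom.mem_nhds p.2] with t hi hj ht
      have hcomm : ∀ a b, Fr.mul t a b = Fr.mul t b a := Fr.mul_comm' t ht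
      have hassoc : ∀ a b c, Fr.mul t (Fr.mul t a b) c = Fr.mul t a (Fr.mul t b c) :=
        Fr.mul_assoc' t ht
      rw [hassoc, hcomm (x j t), hassoc, hj, ← hassoc, hi]
  filter_upwards [hdet, Filter.eventually_all.mpr hx, Filter.eventually_all.mpr fun i =>
    Filter.eventually_all.mpr fun j => Filter.eventually_imp_distrib_left.mpr (horth i j)]
    with t h1 h2 h3
  refine ⟨h1, fun i j => ?_⟩
  split_ifs with hij
  · rw [hij]
    exact h2 j
  · exact h3 i j hij

end FrobeniusStructure

/-! ### Canonical coordinates near a semisimple point -/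

/-- Near p the quotient f/f(p) is close to 1, where the principal logarithm is analytic; the
constant factor is a square root of f(p). -/
theorem AnalyticAt.exists_sq_eq {E : Type*} [NormedAddCommGroup E] [NormedSpace ℂ E] {f : E → ℂ}
    {p : E} (hf : AnalyticAt ℂ f p) (h0 : f p ≠ 0) :
    ∃ s : E → ℂ, AnalyticAt ℂ s p ∧ ∀ᶠ t in nhds p, s t ^ 2 = f t := by
  obtain ⟨c, hc⟩ := IsAlgClosed.exists_pow_nat_eq (f p) two_pos
  have h1 : AnalyticAt ℂ (fun t => f t / f p) p := hf.fun_div analyticAt_const h0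
  refine ⟨fun t => c * Complex.exp (Complex.log (f t / f p) / 2), ?_, ?_⟩
  · refine analyticAt_const.fun_mul (AnalyticAt.cexp ?_)
    refine (h1.clog ?_).fun_div analyticAt_const two_ne_zero
    rw [div_self h0]
    exact Complex.one_mem_slitPlane
  · filter_upwards [hf.continuousAt.eventually_ne h0] with t ht
    rw [mul_pow, hc, ← Complex.exp_nat_mul, Nat.cast_ofNat, mul_div_cancel₀ _ two_ne_zero,
      Complex.exp_log (div_ne_zero ht h0), mul_div_cancel₀ _ h0]

section

variable {N : ℕ}

theorem exists_nhds_injOn {u : Fin N → Pt N → ℂ} {p : Pt N} (hu : ∀ i, AnalyticAt ℂ (u i) p)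
    (hJ : (jacobian u p).det ≠ 0) : ∃ U ∈ nhds p, Set.InjOn (fun t i => u i t) U := by
  have ha : AnalyticAt ℂ (fun t i => u i t) p := AnalyticAt.pi hu
  have hder : ∀ v, fderiv ℂ (fun t i => u i t) p v = jacobian u p *ᵥ v := by
    intro v
    funext i
    rw [fderiv_pi fun i => (hu i).differentiableAt]
    refine (Hol.fderiv_apply_eq_sum (u i) p v).trans ?_
    simp only [Matrix.mulVec, dotProduct, jacobian, Matrix.of_apply, mul_comm]
  have hinj : Function.Injective (fderiv ℂ (fun t i => u i t) p) := by
    refine (injective_iff_map_eq_zero _).mpr fun v hv => ?_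
    rw [hder] at hv
    exact Matrix.eq_zero_of_mulVec_eq_zero hJ hv
  let L : Pt N ≃L[ℂ] Pt N := (LinearEquiv.ofInjectiveEndo
    (fderiv ℂ (fun t i => u i t) p : Pt N →ₗ[ℂ] Pt N) hinj).toContinuousLinearEquiv
  have hL : HasStrictFDerivAt (fun t i => u i t) (L : Pt N →L[ℂ] Pt N) p := ha.hasStrictFDerivAt
  exact ⟨_, (hL.toOpenPartialHomeomorph _).open_source.mem_nhds
    hL.mem_toOpenPartialHomeomorph_source, (hL.toOpenPartialHomeomorph _).injOn⟩

namespace FrobeniusStructure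

variable (Fr : FrobeniusStructure N)

/-- A frame of orthogonal idempotent vector fields is a coordinate frame. -/
theorem exists_jacobian_eq_inv {V : Set (Pt N)} (hV : IsOpen V) (hc : Convex ℝ V)
    (hVd : V ⊆ Fr.dom) {K : Pt N → Matrix (Fin N) (Fin N) ℂ}
    (hK : ∀ β i, AnalyticOnNhd ℂ (fun t => K t β i) V) (hdet : ∀ t ∈ V, (K t).det ≠ 0)
    (h : ∀ t ∈ V, ∀ i j, Fr.mul t (fun β => K t β i) (fun β => K t β j)
      = if i = j then fun β => K t β i else 0) :
    ∃ u : Fin N → Pt N → ℂ, (∀ i, AnalyticOnNhd ℂ (u i) V) ∧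
      ∀ t ∈ V, jacobian u t = (K t)⁻¹ := by
  set Kh : Matrix (Fin N) (Fin N) (Hol V) := Matrix.of fun β i => Hol.mk _ (hK β i) with hKh
  have hKev : ∀ t : V, Kh.map (Hol.ev t) = K t := fun t => rfl
  have hunit : IsUnit Kh.det := by
    refine Hol.isUnit_of_ev_ne_zero fun t => ?_
    have : Hol.ev t Kh.det = (K t).det := by
      rw [← hKev t]
      exact (Hol.ev t).toRingHom.map_det Kh
    rw [this]
    exact hdet t t.2
  have hKJ : Kh * Kh⁻¹ = 1 := Matrix.mul_nonsing_inv _ hunit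
  have hJK : Kh⁻¹ * Kh = 1 := Matrix.nonsing_inv_mul _ hunit
  have hone : ∀ t : V, (1 : Matrix (Fin N) (Fin N) (Hol V)).map (Hol.ev t) = 1 := fun t =>
    Matrix.map_one _ (map_zero _) (map_one _)
  have hJKev : ∀ t : V, Kh⁻¹.map (Hol.ev t) * K t = 1 := fun t => by
    rw [← hKev t, ← Hol.matrix_map_mul, hJK, hone]
  -- The rows of K⁻¹ are the forms dual to the idempotents, and their components are the eigenvalues
  -- of C_α; hence these forms are closed.
  have hcl := fun α β => (der_eq_and_bracket_eq_of_diagonalized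
    (C := Hol.conn Fr hV hVd) (P := Kh⁻¹ᵀ) (Q := Khᵀ) (d := fun α i => Kh⁻¹ i α)
    (der := Hol.partialDer hV)
    (by rw [← Matrix.transpose_mul, hKJ, Matrix.transpose_one])
    (by rw [← Matrix.transpose_mul, hJK, Matrix.transpose_one])
    (fun α => Hol.matrix_ext fun t => by
      rw [Hol.matrix_map_mul, Hol.matrix_map_mul, Hol.conn_map_ev, Matrix.transpose_map,
        Fr.connMatrix_mul (hJKev t) (h t t.2), Matrix.diagonal_map (map_zero _)]
      rfl)
    (fun α β => Hol.conn_map_der Fr hV hVd α β) α β).1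
  choose f hf using fun i => Hol.exists_partialDer_eq hV hc (fun α => Kh⁻¹ i α)
    fun α β => hcl α β i
  refine ⟨fun i => Hol.rep (f i), fun i => Hol.analyticOnNhd_rep _, fun t ht => ?_⟩
  rw [Matrix.inv_eq_left_inv (hJKev ⟨t, ht⟩)]
  ext i β
  rw [jacobian, Matrix.of_apply, ← Hol.ev_partialDer hV β (Hol.ev_eq_rep _) ⟨t, ht⟩, hf]
  rfl

theorem exists_canonicalCoordinates (p : Fr.dom) (hp : Fr.IsSemisimpleAt p) :
    ∃ (V : Set (Pt N)) (u s : Fin N → Pt N → ℂ), IsOpen V ∧ Convex ℝ V ∧ (p : Pt N) ∈ V ∧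
      IsCanonicalCoordinates Fr V u ∧ IsInvSqrtHessian Fr V u s := by
  obtain ⟨K, hKa, hK⟩ := Fr.exists_idempotent_frame p hp
  have hηa : ∀ i, AnalyticAt ℂ
      (fun t => pairing Fr.g (fun β => K t β i) (fun β => K t β i)) p := by
    intro i
    simp only [pairing]
    exact Finset.analyticAt_fun_sum _ fun α _ => Finset.analyticAt_fun_sum _ fun β _ =>
      (analyticAt_const.mul (hKa α i)).mul (hKa β i)
  have hη0 : ∀ i, pairing Fr.g (fun β => K p β i) (fun β => K p β i) ≠ 0 :=
    Fr.pairing_ne_zero p.2 (Matrix.nonsing_inv_mul _ hK.self_of_nhds.1.isUnit)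
      hK.self_of_nhds.2
  choose s hsa hs using fun i => (hηa i).exists_sq_eq (hη0 i)
  obtain ⟨r, hr, hball⟩ := Metric.eventually_nhds_iff_ball.mp
    ((Fr.isOpen_dom.eventually_mem p.2).and <| hK.and <|
      (Filter.eventually_all.mpr fun β => Filter.eventually_all.mpr fun i =>
        (hKa β i).eventually_analyticAt).and <|
      (Filter.eventually_all.mpr fun i => (hsa i).eventually_analyticAt).and <|
        Filter.eventually_all.mpr hs)
  obtain ⟨u, hua, hJ⟩ := Fr.exists_jacobian_eq_inv Metric.isOpen_ball (convex_ball (p : Pt N) r)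
    (fun t ht => (hball t ht).1) (fun β i t ht => (hball t ht).2.2.1 β i)
    (fun t ht => (hball t ht).2.1.1) fun t ht => (hball t ht).2.1.2
  have hJdet : ∀ t ∈ Metric.ball (p : Pt N) r, IsUnit (jacobian u t).det := fun t ht => by
    rw [hJ t ht]
    exact Matrix.isUnit_nonsing_inv_det _ (hball t ht).2.1.1.isUnit
  have hcoord : ∀ t ∈ Metric.ball (p : Pt N) r, ∀ i, coordVec u i t = fun β => K t β i :=
    fun t ht i => by
      funext β
      rw [coordVec, hJ t ht, Matrix.nonsing_inv_nonsing_inv _ (hball t ht).2.1.1.isUnit]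
  have hpr := Metric.mem_ball_self (x := (p : Pt N)) hr
  -- The functions u^i exist on the first ball, but injectivity is only local, so a smaller ball is
  -- taken.
  obtain ⟨U, hU, hinj⟩ := exists_nhds_injOn (fun i => hua i p hpr) (hJdet p hpr).ne_zero
  obtain ⟨r', hr', hsub⟩ := Metric.mem_nhds_iff.mp
    (Filter.inter_mem hU (Metric.ball_mem_nhds (p : Pt N) hr))
  have hmem : ∀ t ∈ Metric.ball (p : Pt N) r', t ∈ Metric.ball (p : Pt N) r :=
    fun t ht => (hsub ht).2
  refine ⟨Metric.ball p r', u, s, Metric.isOpen_ball, convex_ball _ _, Metric.mem_ball_self hr',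
    ⟨fun t ht => (hball t (hmem t ht)).1, fun i t ht => hua i t (hmem t ht),
      hinj.mono fun t ht => (hsub ht).1, fun t ht => hJdet t (hmem t ht), fun t ht i j => ?_⟩,
    fun i => ⟨fun t ht => (hball t (hmem t ht)).2.2.2.1 i, fun t ht => ?_⟩⟩
  · rw [hcoord t (hmem t ht), hcoord t (hmem t ht)]
    exact (hball t (hmem t ht)).2.1.2 i j
  · rw [(hball t (hmem t ht)).2.2.2.2 i, hessian, hcoord t (hmem t ht), one_div, inv_inv]

end FrobeniusStructure

end

theorem mainTheorem4 {N : ℕ} (Fr : FrobeniusStructure N) (p : Fr.dom)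
    (hp : Fr.IsSemisimpleAt p) :
    (∃ (V : Set (Pt N)) (u s : Fin N → Pt N → ℂ),
      IsOpen V ∧ Convex ℝ V ∧ (p : Pt N) ∈ V ∧
        IsCanonicalCoordinates Fr V u ∧ IsInvSqrtHessian Fr V u s) ∧
    ∀ (V : Set (Pt N)) (u s : Fin N → Pt N → ℂ),
      IsOpen V → Convex ℝ V → (p : Pt N) ∈ V →
      IsCanonicalCoordinates Fr V u → IsInvSqrtHessian Fr V u s →
      -- existence of a solution satisfying the unitary condition
      (∃ R : MatrixSeries N, IsAsymptoticSolution Fr V u s R ∧ IsUnitary V R) ∧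
      -- the unitary solutions form one orbit of the unitary diagonal constants
      (∀ R : MatrixSeries N, IsAsymptoticSolution Fr V u s R → IsUnitary V R →
        ∀ R' : MatrixSeries N,
          (IsAsymptoticSolution Fr V u s R' ∧ IsUnitary V R') ↔
            ∃ a : ℕ → Fin N → ℂ, ∀ t ∈ V, R' t = R t * diagExp a) ∧
      -- the conformal case
      (∀ (E : Pt N → Pt N) (D : ℂ), IsEulerField Fr E D →
        ∃ R : MatrixSeries N,
          IsAsymptoticSolution Fr V u s R ∧ IsHomogeneous V E R ∧ IsUnitary V R ∧
          ∀ R' : MatrixSeries N, IsAsymptoticSolution Fr V u s R' → IsHomogeneous V E R' →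
            Set.EqOn R' R V) := by
  refine ⟨Fr.exists_canonicalCoordinates p hp, fun V u s hV hc hpV hu hs => ⟨?_, ?_, ?_⟩⟩
  · exact hu.exists_unitary_solution hV hc ⟨p, hpV⟩ hs
  · exact fun R hR hRu R' => hu.unitary_solution_iff hV hc ⟨p, hpV⟩ hs hR hRu R'
  · exact fun E D hE => hu.exists_homogeneous_solution hV hc ⟨p, hpV⟩ hs hE
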